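/- Let $E$ be a complex Banach lattice, i.e. the complexification $E = E_{\mathbb R} \oplus iE_{\mathbb R}$ of a real Banach lattice $E_{\mathbb R}$, with modulus $|x+iy| = \sup_{\theta\in\mathbb R}\big((\cos\theta)x+(\sin\theta)y\big)$ and norm $\|z\| = \|\,|z|\,\|$. Assume that $E$ has order-continuous norm, i.e. for every nonempty downward directed set $A \subseteq E_{\mathbb R}$ with $\inf A = 0$ one has $\inf_{a\in A}\|a\| = 0$. Let $T$ be a positive bounded linear operator on $E$ (that is, $Tx \in E_{\mathbb R}$ and $Tx \ge 0$ whenever $x \in E_{\mathbb R}$ and $x\ge 0$) with spectral radius $r(T) = 1$, and assume that $T$ is mean ergodic, i.e. the Cesàro means $\frac1n\sum_{k=0}^{n-1}T^k$ converge strongly to a bounded linear operator $P$ on $E$. Then $$\dim\ker(e^{i\theta}-T) \le \dim\ker(e^{in\theta}-T)\qquad\text{for all } n\in\mathbb Z \text{ and } \theta\in\mathbb R,$$ where the dimension of a vector space is understood as an element of $\mathbb N_0\cup\{\infty\}$, i.e. different infinite cardinalities are not distinguished. In particular, the peripheral point spectrum of $T$, i.e. the set of all eigenvalues $\lambda$ of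 $T$ with $|\lambda| = r(T)$, is cyclic: if $r\ge0$, $\theta\in\mathbb R$ and $re^{i\theta}$ belongs to it, then $re^{in\theta}$ belongs to it for every $n\in\mathbb Z$. -/

import Mathlib

open Filter Topology

set_option linter.unusedSectionVars false

/-- A real Banach lattice has order-continuous norm: every nonempty downward directed set with
infimum `0` contains elements of arbitrarily small norm (equivalently, since the norm is monotone
on the positive cone, every decreasing net with infimum `0` converges to `0` in norm). -/
def HasOrderContinuousNorm (E : Type*) [NormedAddCommGroup E] [Lattice E] : Prop :=
  ∀ A : Set E, A.Nonempty → DirectedOn (fun a b : E => b ≤ a) A → IsGLB A 0 →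
    ∀ ε : ℝ, 0 < ε → ∃ a ∈ A, ‖a‖ < ε

/-- The complexification `E ⊕ iE` of a real vector space; the element `⟨x, y⟩` is `x + iy`. -/
@[ext]
structure BLComplexification (E : Type*) where
  re : E
  im : E

namespace BLComplexification

section Algebra

variable {E : Type*} [AddCommGroup E]

instance : Zero (BLComplexification E) := ⟨⟨0, 0⟩⟩
instance : Add (BLComplexification E) := ⟨fun z w => ⟨z.re + w.re, z.im + w.im⟩⟩
instance : Neg (BLComplexification E) := ⟨fun z => ⟨-z.re, -z.im⟩⟩
instance : Sub (BLComplexification E) := ⟨fun z w => ⟨z.re - w.re, z.im - w.im⟩⟩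

@[simp] theorem zero_re : (0 : BLComplexification E).re = 0 := rfl
@[simp] theorem zero_im : (0 : BLComplexification E).im = 0 := rfl
@[simp] theorem add_re (z w : BLComplexification E) : (z + w).re = z.re + w.re := rfl
@[simp] theorem add_im (z w : BLComplexification E) : (z + w).im = z.im + w.im := rfl
@[simp] theorem neg_re (z : BLComplexification E) : (-z).re = -z.re := rfl
@[simp] theorem neg_im (z : BLComplexification E) : (-z).im = -z.im := rfl
@[simp] theorem sub_re (z w : BLComplexification E) : (z - w).re = z.re - w.re := rfl
@[simp] theorem sub_im (z w : BLComplexification E) : (z - w).im = z.im - w.im := rfl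

instance : AddCommGroup (BLComplexification E) where
  add_assoc a b c := by ext <;> simp [add_assoc]
  zero_add a := by ext <;> simp
  add_zero a := by ext <;> simp
  add_comm a b := by ext <;> simp [add_comm]
  neg_add_cancel a := by ext <;> simp
  sub_eq_add_neg a b := by ext <;> simp [sub_eq_add_neg]
  nsmul := nsmulRec
  zsmul := zsmulRec

variable [Module ℝ E]

/-- `(a + ib)(x + iy) = (ax - by) + i(ay + bx)`. -/
instance : SMul ℂ (BLComplexification E) :=
  ⟨fun c z => ⟨c.re • z.re - c.im • z.im, c.re • z.im + c.im • z.re⟩⟩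

@[simp] theorem smul_re (c : ℂ) (z : BLComplexification E) :
    (c • z).re = c.re • z.re - c.im • z.im := rfl
@[simp] theorem smul_im (c : ℂ) (z : BLComplexification E) :
    (c • z).im = c.re • z.im + c.im • z.re := rfl

instance : Module ℂ (BLComplexification E) where
  one_smul a := by ext <;> simp
  mul_smul a b z := by
    ext
    · simp only [smul_re, smul_im, Complex.mul_re, Complex.mul_im]
      module
    · simp only [smul_re, smul_im, Complex.mul_re, Complex.mul_im]
      module
  smul_zero a := by ext <;> simp
  smul_add a z w := by
    ext
    · simp only [smul_re, add_re, add_im]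
      module
    · simp only [smul_im, add_re, add_im]
      module
  add_smul a b z := by
    ext
    · simp only [smul_re, add_re, Complex.add_re, Complex.add_im]
      module
    · simp only [smul_im, add_im, Complex.add_re, Complex.add_im]
      module
  zero_smul z := by ext <;> simp

/-- The embedding of `E` as the real part of its complexification. -/
def ofReal (x : E) : BLComplexification E := ⟨x, 0⟩

end Algebra

section Modulus

variable {E : Type*} [NormedAddCommGroup E] [Lattice E] [HasSolidNorm E] [IsOrderedAddMonoid E]
  [NormedSpace ℝ E] [IsOrderedModule ℝ E] [CompleteSpace E]

/-- The element `Re (e^{-iθ} (x + iy)) = (cos θ) x + (sin θ) y`. -/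
noncomputable def rot (z : BLComplexification E) (θ : ℝ) : E := Real.cos θ • z.re + Real.sin θ • z.im

theorem smul_le_abs_smul_abs (a : ℝ) (x : E) : a • x ≤ |a| • |x| := by
  rcases le_total 0 a with h | h
  · rw [abs_of_nonneg h]
    exact smul_le_smul_of_nonneg_left (le_abs_self x) h
  · rw [abs_of_nonpos h]
    calc a • x = (-a) • (-x) := by simp
      _ ≤ (-a) • |x| := smul_le_smul_of_nonneg_left (neg_le_abs x) (by linarith)

theorem rot_sub_le (z : BLComplexification E) (θ φ : ℝ) :
    rot z θ ≤ rot z φ + |θ - φ| • (|z.re| + |z.im|) := by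
  have h1 : |Real.cos θ - Real.cos φ| ≤ |θ - φ| := by
    simpa using Real.abs_cos_sub_cos_le θ φ
  have h2 : |Real.sin θ - Real.sin φ| ≤ |θ - φ| := by
    simpa using Real.abs_sin_sub_sin_le θ φ
  have e : rot z θ = rot z φ +
      ((Real.cos θ - Real.cos φ) • z.re + (Real.sin θ - Real.sin φ) • z.im) := by
    simp only [rot]
    module
  rw [e, smul_add]
  gcongr
  · exact (smul_le_abs_smul_abs _ _).trans (smul_le_smul_of_nonneg_right h1 (abs_nonneg _))
  · exact (smul_le_abs_smul_abs _ _).trans (smul_le_smul_of_nonneg_right h2 (abs_nonneg _))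

theorem exists_rot_eq (z : BLComplexification E) (θ : ℝ) :
    ∃ φ : ℝ, |φ| ≤ 4 ∧ rot z φ = rot z θ := by
  refine ⟨(θ : Real.Angle).toReal, ?_, ?_⟩
  · exact (Real.Angle.abs_toReal_le_pi _).trans Real.pi_le_four
  · simp [rot]

/-- Suprema of `rot z` over finite grids of angles. -/
noncomputable def gridSup (z : BLComplexification E) (n : ℕ) : E :=
  (Finset.Icc (-4 * ((n : ℤ) + 1)) (4 * ((n : ℤ) + 1))).sup'
    ⟨0, by simp only [Finset.mem_Icc]; constructor <;> linarith [Int.natCast_nonneg n]⟩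
    (fun k => rot z ((k : ℝ) / ((n : ℝ) + 1)))

theorem rot_le_gridSup (z : BLComplexification E) (n : ℕ) (θ : ℝ) :
    rot z θ ≤ gridSup z n + (1 / ((n : ℝ) + 1)) • (|z.re| + |z.im|) := by
  obtain ⟨φ, hφ, e⟩ := exists_rot_eq z θ
  rw [← e]
  have hn : (0 : ℝ) < (n : ℝ) + 1 := by positivity
  obtain ⟨hl, hu⟩ := abs_le.1 hφ
  set k : ℤ := ⌊φ * ((n : ℝ) + 1)⌋ with hk
  have hk1 : (k : ℝ) ≤ φ * ((n : ℝ) + 1) := Int.floor_le _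
  have hk2 : φ * ((n : ℝ) + 1) < (k : ℝ) + 1 := Int.lt_floor_add_one _
  have hmem : k ∈ Finset.Icc (-4 * ((n : ℤ) + 1)) (4 * ((n : ℤ) + 1)) := by
    rw [Finset.mem_Icc]
    constructor
    · rw [hk, Int.le_floor]
      push_cast
      nlinarith
    · have : (k : ℝ) ≤ ((4 * ((n : ℤ) + 1) : ℤ) : ℝ) := by
        push_cast
        nlinarith
      exact_mod_cast this
  refine (rot_sub_le z φ ((k : ℝ) / ((n : ℝ) + 1))).trans ?_
  have hd : |φ - (k : ℝ) / ((n : ℝ) + 1)| ≤ 1 / ((n : ℝ) + 1) := by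
    have : φ - (k : ℝ) / ((n : ℝ) + 1) = (φ * ((n : ℝ) + 1) - k) / ((n : ℝ) + 1) := by
      field_simp
    rw [this, abs_of_nonneg (div_nonneg (by linarith) hn.le)]
    gcongr
    linarith
  have hs : rot z ((k : ℝ) / ((n : ℝ) + 1)) ≤ gridSup z n :=
    Finset.le_sup' (fun k : ℤ => rot z ((k : ℝ) / ((n : ℝ) + 1))) hmem
  exact add_le_add hs
    (smul_le_smul_of_nonneg_right hd (add_nonneg (abs_nonneg _) (abs_nonneg _)))

theorem gridSup_le (z : BLComplexification E) (n : ℕ) {b : E} (hb : ∀ θ, rot z θ ≤ b) :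
    gridSup z n ≤ b :=
  Finset.sup'_le _ _ fun _ _ => hb _

theorem cauchySeq_gridSup (z : BLComplexification E) : CauchySeq (gridSup z) := by
  set u : E := |z.re| + |z.im| with hu
  have hu0 : 0 ≤ u := add_nonneg (abs_nonneg _) (abs_nonneg _)
  have key : ∀ N m n : ℕ, N ≤ m → N ≤ n →
      gridSup z m - gridSup z n ≤ (1 / ((N : ℝ) + 1)) • u := by
    intro N m n _ hn
    rw [sub_le_iff_le_add']
    refine (gridSup_le z m (rot_le_gridSup z n)).trans ?_
    refine add_le_add le_rfl (smul_le_smul_of_nonneg_right ?_ hu0)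
    have : (N : ℝ) ≤ n := by exact_mod_cast hn
    gcongr
  refine cauchySeq_of_le_tendsto_0 (fun N : ℕ => (1 / ((N : ℝ) + 1)) * ‖u‖) ?_ ?_
  · intro m n N hm hn
    have h0 : (0 : ℝ) ≤ 1 / ((N : ℝ) + 1) := by positivity
    have h : |gridSup z m - gridSup z n| ≤ |(1 / ((N : ℝ) + 1)) • u| := by
      rw [abs_of_nonneg (smul_nonneg h0 hu0)]
      refine abs_le'.2 ⟨key N m n hm hn, ?_⟩
      rw [neg_sub]
      exact key N n m hn hm
    rw [dist_eq_norm]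
    refine (norm_le_norm_of_abs_le_abs h).trans ?_
    rw [norm_smul, Real.norm_of_nonneg h0]
  · simpa using (tendsto_one_div_add_atTop_nhds_zero_nat (𝕜 := ℝ)).mul_const ‖u‖

theorem exists_isLUB_rot (z : BLComplexification E) : ∃ m : E, IsLUB (Set.range (rot z)) m := by
  obtain ⟨m, hm⟩ := cauchySeq_tendsto_of_complete (cauchySeq_gridSup z)
  refine ⟨m, ?_, ?_⟩
  · rintro _ ⟨θ, rfl⟩
    have h : Tendsto (fun n : ℕ => gridSup z n + (1 / ((n : ℝ) + 1)) • (|z.re| + |z.im|))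
        atTop (𝓝 (m + (0 : ℝ) • (|z.re| + |z.im|))) :=
      hm.add ((tendsto_one_div_add_atTop_nhds_zero_nat (𝕜 := ℝ)).smul_const _)
    rw [zero_smul, add_zero] at h
    exact ge_of_tendsto' h fun n => rot_le_gridSup z n θ
  · intro b hb
    exact le_of_tendsto' hm fun n => gridSup_le z n fun θ => hb ⟨θ, rfl⟩

/-- The modulus `|x + iy| = sup_θ ((cos θ) x + (sin θ) y)`; the supremum exists in `E`. -/
noncomputable def modulus (z : BLComplexification E) : E := (exists_isLUB_rot z).choose

theorem isLUB_modulus (z : BLComplexification E) : IsLUB (Set.range (rot z)) (modulus z) :=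
  (exists_isLUB_rot z).choose_spec

theorem rot_le_modulus (z : BLComplexification E) (θ : ℝ) : rot z θ ≤ modulus z :=
  (isLUB_modulus z).1 ⟨θ, rfl⟩

theorem modulus_le (z : BLComplexification E) {b : E} (hb : ∀ θ, rot z θ ≤ b) :
    modulus z ≤ b :=
  (isLUB_modulus z).2 (by rintro _ ⟨θ, rfl⟩; exact hb θ)

theorem abs_re_le_modulus (z : BLComplexification E) : |z.re| ≤ modulus z :=
  abs_le'.2 ⟨by simpa [rot] using rot_le_modulus z 0,
    by simpa [rot] using rot_le_modulus z Real.pi⟩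

theorem abs_im_le_modulus (z : BLComplexification E) : |z.im| ≤ modulus z :=
  abs_le'.2 ⟨by simpa [rot] using rot_le_modulus z (Real.pi / 2),
    by simpa [rot] using rot_le_modulus z (-(Real.pi / 2))⟩

theorem modulus_nonneg (z : BLComplexification E) : 0 ≤ modulus z :=
  (abs_nonneg _).trans (abs_re_le_modulus z)

theorem modulus_le_add (z : BLComplexification E) : modulus z ≤ |z.re| + |z.im| := by
  refine modulus_le z fun θ => add_le_add ?_ ?_
  · exact (smul_le_abs_smul_abs _ _).trans
      (smul_le_of_le_one_left (abs_nonneg _) (Real.abs_cos_le_one θ))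
  · exact (smul_le_abs_smul_abs _ _).trans
      (smul_le_of_le_one_left (abs_nonneg _) (Real.abs_sin_le_one θ))

theorem modulus_add_le (z w : BLComplexification E) :
    modulus (z + w) ≤ modulus z + modulus w := by
  refine modulus_le _ fun θ => ?_
  have : rot (z + w) θ = rot z θ + rot w θ := by
    simp only [rot, add_re, add_im]
    module
  rw [this]
  exact add_le_add (rot_le_modulus z θ) (rot_le_modulus w θ)

theorem rot_smul (c : ℂ) (z : BLComplexification E) (θ : ℝ) :
    rot (c • z) θ = ‖c‖ • rot z (θ - c.arg) := by
  have h1 : ‖c‖ * Real.cos c.arg = c.re := Complex.norm_mul_cos_arg c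
  have h2 : ‖c‖ * Real.sin c.arg = c.im := Complex.norm_mul_sin_arg c
  simp only [rot, smul_re, smul_im, Real.cos_sub, Real.sin_sub]
  rw [← h1, ← h2]
  module

theorem modulus_smul (c : ℂ) (z : BLComplexification E) :
    modulus (c • z) = ‖c‖ • modulus z := by
  have hle : ∀ (c : ℂ) (z : BLComplexification E), modulus (c • z) ≤ ‖c‖ • modulus z := by
    intro c z
    refine modulus_le _ fun θ => ?_
    rw [rot_smul]
    exact smul_le_smul_of_nonneg_left (rot_le_modulus _ _) (norm_nonneg c)
  refine le_antisymm (hle c z) ?_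
  rcases eq_or_ne c 0 with rfl | hc
  · simpa using modulus_nonneg _
  · have h := hle c⁻¹ (c • z)
    rw [inv_smul_smul₀ hc] at h
    have h' := smul_le_smul_of_nonneg_left h (norm_nonneg c)
    rwa [norm_inv, smul_inv_smul₀ (norm_ne_zero_iff.2 hc)] at h'

theorem norm_le_of_modulus_le {x : E} {z : BLComplexification E} (h : |x| ≤ modulus z) :
    ‖x‖ ≤ ‖modulus z‖ :=
  norm_le_norm_of_abs_le_abs (h.trans (le_abs_self _))

theorem norm_mono_of_nonneg {x y : E} (hx : 0 ≤ x) (h : x ≤ y) : ‖x‖ ≤ ‖y‖ :=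
  norm_le_norm_of_abs_le_abs (by rwa [abs_of_nonneg hx, abs_of_nonneg (hx.trans h)])

/-- The norm of the complex Banach lattice: `‖z‖ = ‖|z|‖`. -/
noncomputable instance : Norm (BLComplexification E) := ⟨fun z => ‖modulus z‖⟩

theorem norm_def (z : BLComplexification E) : ‖z‖ = ‖modulus z‖ := rfl

theorem norm_re_le (z : BLComplexification E) : ‖z.re‖ ≤ ‖z‖ :=
  norm_le_of_modulus_le (abs_re_le_modulus z)

theorem norm_im_le (z : BLComplexification E) : ‖z.im‖ ≤ ‖z‖ :=
  norm_le_of_modulus_le (abs_im_le_modulus z)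

theorem norm_le_add (z : BLComplexification E) : ‖z‖ ≤ ‖z.re‖ + ‖z.im‖ := by
  refine (norm_mono_of_nonneg (modulus_nonneg z) (modulus_le_add z)).trans ?_
  refine (_root_.norm_add_le _ _).trans ?_
  rw [norm_abs_eq_norm, norm_abs_eq_norm]

theorem normedSpaceCore : NormedSpace.Core ℂ (BLComplexification E) where
  norm_nonneg z := _root_.norm_nonneg (modulus z)
  norm_smul c z := by
    rw [norm_def, modulus_smul, _root_.norm_smul, norm_norm, ← norm_def]
  norm_triangle z w :=
    (norm_mono_of_nonneg (modulus_nonneg _) (modulus_add_le z w)).trans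
      (_root_.norm_add_le _ _)
  norm_eq_zero_iff z := by
    constructor
    · intro h
      ext
      · exact norm_le_zero_iff.1 ((norm_re_le z).trans h.le)
      · exact norm_le_zero_iff.1 ((norm_im_le z).trans h.le)
    · rintro rfl
      have h : ‖(0 : BLComplexification E)‖ ≤ 0 := by simpa using norm_le_add (0 : BLComplexification E)
      exact le_antisymm h (_root_.norm_nonneg (modulus (0 : BLComplexification E)))

noncomputable instance : NormedAddCommGroup (BLComplexification E) :=
  NormedAddCommGroup.ofCore normedSpaceCore

noncomputable instance : NormedSpace ℂ (BLComplexification E) :=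
  NormedSpace.ofCore normedSpaceCore

theorem dist_re_le (z w : BLComplexification E) : dist z.re w.re ≤ dist z w := by
  rw [dist_eq_norm, dist_eq_norm]
  exact norm_re_le (z - w)

theorem dist_im_le (z w : BLComplexification E) : dist z.im w.im ≤ dist z w := by
  rw [dist_eq_norm, dist_eq_norm]
  exact norm_im_le (z - w)

theorem dist_le_add (z w : BLComplexification E) :
    dist z w ≤ dist z.re w.re + dist z.im w.im := by
  rw [dist_eq_norm, dist_eq_norm, dist_eq_norm]
  exact norm_le_add (z - w)

theorem cauchySeq_of_dist_le {α β : Type*} [PseudoMetricSpace α] [PseudoMetricSpace β]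
    {u : ℕ → α} (f : α → β) (hf : ∀ a b, dist (f a) (f b) ≤ dist a b) (hu : CauchySeq u) :
    CauchySeq fun n => f (u n) := by
  rw [Metric.cauchySeq_iff] at hu ⊢
  intro ε hε
  obtain ⟨N, hN⟩ := hu ε hε
  exact ⟨N, fun m hm n hn => lt_of_le_of_lt (hf _ _) (hN m hm n hn)⟩

theorem exists_tendsto_of_cauchySeq (u : ℕ → BLComplexification E) (hu : CauchySeq u) :
    ∃ z, Tendsto u atTop (𝓝 z) := by
  obtain ⟨x, hx⟩ := cauchySeq_tendsto_of_complete (cauchySeq_of_dist_le re dist_re_le hu)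
  obtain ⟨y, hy⟩ := cauchySeq_tendsto_of_complete (cauchySeq_of_dist_le im dist_im_le hu)
  refine ⟨⟨x, y⟩, ?_⟩
  rw [tendsto_iff_dist_tendsto_zero] at hx hy ⊢
  have hxy := hx.add hy
  rw [add_zero] at hxy
  exact squeeze_zero (fun _ => dist_nonneg) (fun n => dist_le_add (u n) ⟨x, y⟩) hxy

instance : CompleteSpace (BLComplexification E) :=
  Metric.complete_of_cauchySeq_tendsto exists_tendsto_of_cauchySeq

/-- A bounded operator on the complex Banach lattice is positive: it maps positive elements (of the
real part `E`) to positive elements (of the real part `E`). -/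
def IsPositiveOperator (T : BLComplexification E →L[ℂ] BLComplexification E) : Prop :=
  ∀ x : E, 0 ≤ x → ∃ y : E, 0 ≤ y ∧ T (ofReal x) = ofReal y

end Modulus

end BLComplexification

section Operators

variable {X : Type*} [NormedAddCommGroup X] [NormedSpace ℂ X]

/-- `T` is mean ergodic: the Cesàro means `(1/n) ∑_{k<n} T^k` converge strongly to a bounded
operator. -/
def IsMeanErgodic (T : X →L[ℂ] X) : Prop :=
  ∃ P : X →L[ℂ] X, ∀ x : X,
    Tendsto (fun n : ℕ => (n : ℂ)⁻¹ • ∑ k ∈ Finset.range n, (T ^ k) x) atTop (𝓝 (P x))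

/-- The dimension of `ker (μ - T)`, as an integer or `∞` (infinite cardinalities are not
distinguished). -/
noncomputable def dimKer (T : X →L[ℂ] X) (μ : ℂ) : ℕ∞ :=
  Cardinal.toENat (Module.rank ℂ
    (LinearMap.ker ((μ • ContinuousLinearMap.id ℂ X - T : X →L[ℂ] X) : X →ₗ[ℂ] X)))

/-- The set of eigenvalues of `T` of modulus `r(T)`. -/
def peripheralPointSpectrum (T : X →L[ℂ] X) : Set ℂ :=
  {μ : ℂ | Module.End.HasEigenvalue (T : X →ₗ[ℂ] X) μ ∧ ‖μ‖ₑ = spectralRadius ℂ T}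

end Operators

/-- A set `M ⊆ ℂ` is cyclic if `r e^{iθ} ∈ M` (`r ≥ 0`, `θ ∈ ℝ`) implies `r e^{inθ} ∈ M` for all
`n ∈ ℤ`. -/
def IsCyclicSet (M : Set ℂ) : Prop :=
  ∀ r θ : ℝ, 0 ≤ r → (r : ℂ) * Complex.exp (Complex.I * θ) ∈ M →
    ∀ n : ℤ, (r : ℂ) * Complex.exp (Complex.I * (n * θ)) ∈ M

/-! ### Vector lattices: maximal ideals and real lattice homomorphisms. -/

section VectorLattice

variable {V : Type*} [AddCommGroup V] [Lattice V] [IsOrderedAddMonoid V] [Module ℝ V]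
  [IsOrderedModule ℝ V]

/-! Let `T z = λ z` with `|λ| = 1`, and let `P` be the Cesàro limit on the real part, so that `T P =
P = P T`. From `|z| = |T z| ≤ T |z|` follows `|z| ≤ P |z|`, and `P |z|` is a fixed vector. Hence
finitely many eigenvectors lie in the principal ideal `E_u` of a single fixed vector `u ≥ 0`. By
Kakutani's theorem `E_u` is a `C(K)`, where `K` is the compact space of lattice homomorphisms
normalised at `u`, and `T` restricts to a positive operator on it that fixes the unit.

Let `N = {x | P |x| = 0}`, a closed `T`-invariant ideal. For `φ ∈ K` the functional `φ ∘ T` is a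
probability measure on `K`, so Jensen's inequality for `h = |z|²` gives `h ≤ T h`; as `P (T h - h) =
0`, the difference lies in `N`. If `φ` vanishes on `N`, equality therefore holds in Jensen's
inequality, and on functions of `z` the measure `φ ∘ T` acts as evaluation at `λ φ(z)`. So `T (F(z))
≡ F(λ z)` modulo `N` for continuous `F`, and for `F(s) = s^k conj(s)^l` the element `F(z)` is an
eigenvector modulo `N` for `λ^(k-l)` (`IsPositiveOperator.exists_monomial`).

Order continuity removes the error in `N`: the orbit of such an element under `λ^(-n) T` stays
within some `v ∈ N` with `T^k v → 0`, so it converges to a genuine eigenvector congruent to the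
element modulo `N` (`IsPositiveOperator.exists_eigenvector`).

Since `|z| ≤ P |z|`, no nonzero `λ`-eigenvector lies in `N`, so homomorphisms vanishing on `N`
separate the eigenvectors. A basis biorthogonal to such homomorphisms remains biorthogonal under
`F`, which fixes `0` and `1`, and under the correction in `N`. This preserves dimension. -/

theorem abs_real_smul_le (c : ℝ) (x : V) : |c • x| ≤ |c| • |x| := by
  have key : ∀ (a : ℝ) (y : V), a • y ≤ |a| • |y| := by
    intro a y
    rcases le_total 0 a with h | h
    · rw [abs_of_nonneg h]
      exact smul_le_smul_of_nonneg_left (le_abs_self y) h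
    · rw [abs_of_nonpos h, ← neg_smul_neg a y]
      exact smul_le_smul_of_nonneg_left (neg_le_abs y) (by linarith)
  refine abs_le'.2 ⟨key c x, ?_⟩
  rw [← neg_smul, ← abs_neg c]
  exact key _ _

theorem abs_real_smul (c : ℝ) (x : V) : |c • x| = |c| • |x| := by
  refine le_antisymm (abs_real_smul_le c x) ?_
  rcases eq_or_ne c 0 with rfl | hc
  · simp
  · have h := smul_le_smul_of_nonneg_left (abs_real_smul_le c⁻¹ (c • x)) (abs_nonneg c)
    rwa [inv_smul_smul₀ hc, abs_inv, smul_inv_smul₀ (abs_ne_zero.2 hc)] at h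

/-- A linear subspace of a vector lattice is an ideal if it is solid. -/
def IsLatticeIdeal (N : Submodule ℝ V) : Prop :=
  ∀ ⦃x y : V⦄, |x| ≤ |y| → y ∈ N → x ∈ N

theorem IsLatticeIdeal.mem_of_abs_le {N : Submodule ℝ V} (hN : IsLatticeIdeal N) {x y : V}
    (h : |x| ≤ y) (hy : y ∈ N) : x ∈ N :=
  hN (h.trans (le_abs_self y)) hy

theorem IsLatticeIdeal.mem_of_le {N : Submodule ℝ V} (hN : IsLatticeIdeal N) {x y : V}
    (hx : 0 ≤ x) (h : x ≤ y) (hy : y ∈ N) : x ∈ N :=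
  hN.mem_of_abs_le (by rwa [abs_of_nonneg hx]) hy

theorem IsLatticeIdeal.abs_mem {N : Submodule ℝ V} (hN : IsLatticeIdeal N) {x : V}
    (hx : x ∈ N) : |x| ∈ N :=
  hN (abs_abs x).le hx

/-- Disjointness of `y⁺` and `y⁻`; dividing by `c + 1` rather than `c` covers `c = 0`. -/
theorem le_zero_of_le_smul_posPart {z y : V} {c : ℝ} (hc : 0 ≤ c) (h₁ : z ≤ c • y⁺)
    (h₂ : z ≤ c • y⁻) : z ≤ 0 := by
  have hc' : (0 : ℝ) < c + 1 := by linarith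
  have h : (c + 1)⁻¹ • z ≤ y⁺ ⊓ y⁻ := by
    refine le_inf ?_ ?_
    · rw [inv_smul_le_iff_of_pos hc']
      exact h₁.trans (smul_le_smul_of_nonneg_right (by linarith) (posPart_nonneg y))
    · rw [inv_smul_le_iff_of_pos hc']
      exact h₂.trans (smul_le_smul_of_nonneg_right (by linarith) (negPart_nonneg y))
  rw [posPart_inf_negPart_eq_zero, inv_smul_le_iff_of_pos hc', smul_zero] at h
  exact h

/-- The ideal generated by an ideal `N` and an element `y`. -/
def idealAdjoin (N : Submodule ℝ V) (y : V) : Submodule ℝ V where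
  carrier := {x | ∃ m ∈ N, ∃ c : ℝ, 0 ≤ c ∧ |x| ≤ m + c • |y|}
  zero_mem' := ⟨0, N.zero_mem, 0, le_rfl, by simp⟩
  add_mem' := by
    rintro a b ⟨m, hm, c, hc, h⟩ ⟨m', hm', c', hc', h'⟩
    refine ⟨m + m', N.add_mem hm hm', c + c', add_nonneg hc hc', (abs_add_le a b).trans ?_⟩
    refine (add_le_add h h').trans (le_of_eq ?_)
    module
  smul_mem' := by
    rintro r a ⟨m, hm, c, hc, h⟩
    refine ⟨|r| • m, N.smul_mem _ hm, |r| * c, mul_nonneg (abs_nonneg r) hc, ?_⟩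
    rw [abs_real_smul, mul_smul, ← smul_add]
    exact smul_le_smul_of_nonneg_left h (abs_nonneg r)

theorem isLatticeIdeal_idealAdjoin (N : Submodule ℝ V) (y : V) :
    IsLatticeIdeal (idealAdjoin N y) := by
  rintro a b hab ⟨m, hm, c, hc, h⟩
  exact ⟨m, hm, c, hc, hab.trans h⟩

theorem le_idealAdjoin (N : Submodule ℝ V) (hN : IsLatticeIdeal N) (y : V) :
    N ≤ idealAdjoin N y :=
  fun x hx => ⟨|x|, hN.abs_mem hx, 0, le_rfl, by simp⟩

theorem mem_idealAdjoin_self (N : Submodule ℝ V) (y : V) :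
    y ∈ idealAdjoin N y :=
  ⟨0, N.zero_mem, 1, zero_le_one, by simp⟩

/-- Zorn's lemma for the ideals that avoid `u`. Maximality is recorded as an inequality for `u`, the
form in which it is used below. -/
theorem exists_maximal_latticeIdeal {N : Submodule ℝ V} (hN : IsLatticeIdeal N) {u : V}
    (hu : u ∉ N) : ∃ M : Submodule ℝ V, N ≤ M ∧ IsLatticeIdeal M ∧ u ∉ M ∧
      ∀ y : V, y ∉ M → u ∈ idealAdjoin M y := by
  obtain ⟨M, hNM, hM⟩ := zorn_le_nonempty₀ {M : Submodule ℝ V | IsLatticeIdeal M ∧ u ∉ M}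
    (by
      intro c hc hchain y hy
      have hmem : ∀ x : V, x ∈ sSup c ↔ ∃ M ∈ c, x ∈ M := fun x =>
        Submodule.mem_sSup_of_directed ⟨y, hy⟩ hchain.directedOn
      refine ⟨sSup c, ⟨?_, ?_⟩, fun z hz => le_sSup hz⟩
      · intro a b hab hb
        obtain ⟨M, hM, hbM⟩ := (hmem b).1 hb
        exact (hmem a).2 ⟨M, hM, (hc hM).1 hab hbM⟩
      · intro h
        obtain ⟨M, hM, huM⟩ := (hmem u).1 h
        exact (hc hM).2 huM) N ⟨hN, hu⟩
  refine ⟨M, hNM, hM.prop.1, hM.prop.2, fun y hy => ?_⟩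
  by_contra hcon
  have := hM.le_of_ge ⟨isLatticeIdeal_idealAdjoin M y, hcon⟩ (le_idealAdjoin M hM.prop.1 y)
  exact hy (this (mem_idealAdjoin_self M y))

/-- `φ` is a linear lattice homomorphism into `ℝ` with `φ u = 1`. -/
structure IsLatticeCharacter (u : V) (φ : V → ℝ) : Prop where
  map_add : ∀ x y, φ (x + y) = φ x + φ y
  map_smul : ∀ (c : ℝ) x, φ (c • x) = c * φ x
  map_abs : ∀ x, φ |x| = |φ x|
  map_unit : φ u = 1

/-- `u` is a strong order unit. -/
def IsStrongUnit (u : V) : Prop := 0 ≤ u ∧ ∀ x : V, ∃ c : ℝ, 0 ≤ c ∧ |x| ≤ c • u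

/-- A maximal ideal is prime: otherwise `u` is bounded modulo `M` by multiples of both `y⁺` and
`y⁻`, which are disjoint, and so `u ∈ M`. -/
theorem posPart_mem_or_negPart_mem {u : V} (hu0 : 0 ≤ u) {M : Submodule ℝ V}
    (hM : IsLatticeIdeal M) (huM : u ∉ M)
    (hmax : ∀ y : V, y ∉ M → u ∈ idealAdjoin M y) (y : V) :
    y⁺ ∈ M ∨ y⁻ ∈ M := by
  by_contra! hcon
  obtain ⟨m, hm, c, hc, h⟩ := hmax _ hcon.1
  obtain ⟨m', hm', c', hc', h'⟩ := hmax _ hcon.2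
  rw [abs_of_nonneg hu0, abs_of_nonneg (posPart_nonneg y)] at h
  rw [abs_of_nonneg hu0, abs_of_nonneg (negPart_nonneg y)] at h'
  have h₀ : u - (|m| + |m'|) ≤ 0 := by
    refine le_zero_of_le_smul_posPart (c := c + c') (y := y) (add_nonneg hc hc') ?_ ?_
    · rw [sub_le_iff_le_add']
      refine h.trans (add_le_add ?_ (smul_le_smul_of_nonneg_right (by linarith)
        (posPart_nonneg y)))
      exact (le_abs_self m).trans (le_add_of_nonneg_right (abs_nonneg m'))
    · rw [sub_le_iff_le_add']
      refine h'.trans (add_le_add ?_ (smul_le_smul_of_nonneg_right (by linarith)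
        (negPart_nonneg y)))
      exact (le_abs_self m').trans (le_add_of_nonneg_left (abs_nonneg m))
  exact huM (hM.mem_of_le hu0 (sub_nonpos.1 h₀) (M.add_mem (hM.abs_mem hm) (hM.abs_mem hm')))

/-- The quotient by `M` is totally ordered by primeness, and maximality makes it one-dimensional;
the coefficient of `x` is found by a Dedekind cut. -/
theorem exists_sub_smul_mem {u : V} (hu : IsStrongUnit u) {M : Submodule ℝ V}
    (hM : IsLatticeIdeal M) (huM : u ∉ M)
    (hmax : ∀ y : V, y ∉ M → u ∈ idealAdjoin M y) (x : V) :
    ∃ c : ℝ, x - c • u ∈ M := by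
  obtain ⟨k, hk, hxk⟩ := hu.2 x
  obtain ⟨hxk₁, hxk₂⟩ := abs_le'.1 hxk
  -- Membership of `c` means `c • u ≤ x` modulo `M`.
  set A : Set ℝ := {c | (c • u - x)⁺ ∈ M} with hA
  have hne : A.Nonempty := by
    refine ⟨-k, ?_⟩
    have : (-k) • u - x ≤ 0 := by
      rw [neg_smul, sub_nonpos]
      exact neg_le.1 hxk₂
    rw [hA, Set.mem_ofPred_eq, posPart_eq_zero.2 this]
    exact M.zero_mem
  have hbdd : BddAbove A := by
    refine ⟨k, fun c hc => ?_⟩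
    by_contra! hck
    have h1 : (c - k) • u ≤ (c • u - x)⁺ := by
      refine le_trans ?_ (le_posPart _)
      rw [sub_smul]
      exact sub_le_sub_left hxk₁ _
    have h2 := hM.mem_of_le (smul_nonneg (sub_pos.2 hck).le hu.1) h1 hc
    exact huM ((M.smul_mem_iff (sub_pos.2 hck).ne').1 h2)
  set s := sSup A with hs
  refine ⟨s, ?_⟩
  by_contra hcon
  obtain ⟨m, hm, c, hc, h⟩ := hmax _ hcon
  rw [abs_of_nonneg hu.1] at h
  have hbound : ∀ ε : ℝ, 0 < ε → ∃ n ∈ M, |x - s • u| ≤ n + ε • u := by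
    intro ε hε
    obtain ⟨a, haA, has⟩ := exists_lt_of_lt_csSup hne (show s - ε < sSup A by linarith)
    have hb : s + ε ∉ A := fun hb => by
      have := le_csSup hbdd hb
      linarith
    have hb' : ((s + ε) • u - x)⁻ ∈ M :=
      (posPart_mem_or_negPart_mem hu.1 hM huM hmax _).resolve_left hb
    have n1 : (0 : V) ≤ (a • u - x)⁺ := posPart_nonneg _
    have n2 : (0 : V) ≤ ((s + ε) • u - x)⁻ := negPart_nonneg _
    refine ⟨_, M.add_mem haA hb', abs_le'.2 ⟨?_, ?_⟩⟩
    · have e : x - s • u = -((s + ε) • u - x) + ε • u := by module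
      rw [e]
      refine add_le_add ?_ le_rfl
      exact (neg_le_negPart _).trans (le_add_of_nonneg_left n1)
    · have e : -(x - s • u) = (a • u - x) + (s - a) • u := by module
      rw [e]
      refine add_le_add ((le_posPart _).trans (le_add_of_nonneg_right n2)) ?_
      exact smul_le_smul_of_nonneg_right (by linarith) hu.1
  -- This `ε` makes `c * ε < 1`, so the term `(c * ε) • u` can be absorbed into `u`.
  obtain ⟨n, hn, hn'⟩ := hbound (2 * (c + 1))⁻¹ (by positivity)
  have h3 : (1 - c * (2 * (c + 1))⁻¹) • u ≤ m + c • n := by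
    have h4 := smul_le_smul_of_nonneg_left hn' hc
    have h5 := h.trans (add_le_add le_rfl h4)
    rw [sub_smul, one_smul, sub_le_iff_le_add]
    refine h5.trans (le_of_eq ?_)
    module
  have hpos : 0 < 1 - c * (2 * (c + 1))⁻¹ := by
    have : c * (2 * (c + 1))⁻¹ < 1 := by
      rw [← div_eq_mul_inv, div_lt_one (by positivity)]
      linarith
    linarith
  have h6 := hM.mem_of_le (smul_nonneg hpos.le hu.1) h3 (M.add_mem hm (M.smul_mem c hn))
  exact huM ((M.smul_mem_iff hpos.ne').1 h6)

/-- `φ x` is the coordinate of `x` along `u` modulo `M`. Its uniqueness turns each law into a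
membership in `M`; for the modulus this is `||x| - |φ x • u|| ≤ |x - φ x • u|`. -/
theorem exists_isLatticeCharacter_of_maximal {u : V} (hu : IsStrongUnit u) {M : Submodule ℝ V}
    (hM : IsLatticeIdeal M) (huM : u ∉ M)
    (hmax : ∀ y : V, y ∉ M → u ∈ idealAdjoin M y) :
    ∃ φ : V → ℝ, IsLatticeCharacter u φ ∧ ∀ x ∈ M, φ x = 0 := by
  choose φ hφ using exists_sub_smul_mem hu hM huM hmax
  have huniq : ∀ (x : V) (c : ℝ), x - c • u ∈ M → φ x = c := by
    intro x c h
    by_contra hne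
    have h' := M.sub_mem h (hφ x)
    have e : x - c • u - (x - φ x • u) = (φ x - c) • u := by module
    rw [e] at h'
    exact huM ((M.smul_mem_iff (sub_ne_zero.2 hne)).1 h')
  refine ⟨φ, ⟨fun x y => huniq _ _ ?_, fun c x => huniq _ _ ?_, fun x => huniq _ _ ?_,
    huniq _ _ (by simp)⟩, fun x hx => huniq _ _ (by simpa using hx)⟩
  · have e : x + y - (φ x + φ y) • u = (x - φ x • u) + (y - φ y • u) := by module
    rw [e]
    exact M.add_mem (hφ x) (hφ y)
  · have e : c • x - (c * φ x) • u = c • (x - φ x • u) := by module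
    rw [e]
    exact M.smul_mem c (hφ x)
  · have e : |φ x| • u = |φ x • u| := by rw [abs_real_smul, abs_of_nonneg hu.1]
    rw [e]
    exact hM (abs_abs_sub_abs_le x (φ x • u)) (hφ x)

theorem IsLatticeCharacter.map_sub {u : V} {φ : V → ℝ} (h : IsLatticeCharacter u φ) (x y : V) :
    φ (x - y) = φ x - φ y := by
  have := h.map_smul (-1) y
  rw [neg_one_smul, neg_one_mul] at this
  rw [sub_eq_add_neg, h.map_add, this, sub_eq_add_neg]

theorem IsLatticeCharacter.nonneg {u : V} {φ : V → ℝ} (h : IsLatticeCharacter u φ) {x : V}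
    (hx : 0 ≤ x) : 0 ≤ φ x := by
  rw [← abs_of_nonneg hx, h.map_abs]
  exact abs_nonneg _

theorem IsLatticeCharacter.mono {u : V} {φ : V → ℝ} (h : IsLatticeCharacter u φ) {x y : V}
    (hxy : x ≤ y) : φ x ≤ φ y := by
  have := h.nonneg (sub_nonneg.2 hxy)
  rw [h.map_sub] at this
  linarith

/-- Real lattice homomorphisms vanishing on an ideal detect elements outside the ideal. -/
theorem exists_isLatticeCharacter {u : V} (hu : IsStrongUnit u) {N : Submodule ℝ V}
    (hN : IsLatticeIdeal N) {x : V} {ε : ℝ} (hx : (x - ε • u)⁺ ∉ N) :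
    ∃ φ : V → ℝ, IsLatticeCharacter u φ ∧ (∀ y ∈ N, φ y = 0) ∧ ε ≤ φ x := by
  set y := x - ε • u with hy
  -- Adjoining `y⁻` forces `φ y⁻ = 0`, hence `φ y ≥ 0`. If this ideal contained `u`, then `y⁺` would
  -- be at most an element of `N` plus a multiple of `y⁻`, and disjointness would put `y⁺` in `N`.
  have huI : u ∉ idealAdjoin N y⁻ := by
    rintro ⟨n, hn, c, hc, h⟩
    rw [abs_of_nonneg hu.1, abs_of_nonneg (negPart_nonneg y)] at h
    obtain ⟨k, hk, hyk⟩ := hu.2 y⁺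
    rw [abs_of_nonneg (posPart_nonneg y)] at hyk
    have h1 : y⁺ ≤ k • n + (k * c) • y⁻ := by
      refine hyk.trans ((smul_le_smul_of_nonneg_left h hk).trans (le_of_eq ?_))
      module
    have h2 : y⁺ - k • |n| ≤ 0 := by
      have hkn : k • n ≤ k • |n| := smul_le_smul_of_nonneg_left (le_abs_self n) hk
      have hkn0 : 0 ≤ k • |n| := smul_nonneg hk (abs_nonneg n)
      refine le_zero_of_le_smul_posPart (c := k * c + 1) (y := y) (by positivity) ?_ ?_
      · refine (sub_le_self _ hkn0).trans ?_
        have := smul_le_smul_of_nonneg_right (show (1 : ℝ) ≤ k * c + 1 by nlinarith)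
          (posPart_nonneg y)
        rwa [one_smul] at this
      · rw [sub_le_iff_le_add']
        exact h1.trans (add_le_add hkn
          (smul_le_smul_of_nonneg_right (by linarith) (negPart_nonneg y)))
    exact hx (hN.mem_of_le (posPart_nonneg y) (sub_nonpos.1 h2)
      (N.smul_mem k (hN.abs_mem hn)))
  obtain ⟨M, hIM, hM, huM, hmax⟩ :=
    exists_maximal_latticeIdeal (isLatticeIdeal_idealAdjoin N y⁻) huI
  obtain ⟨φ, hφ, hφM⟩ := exists_isLatticeCharacter_of_maximal hu hM huM hmax
  refine ⟨φ, hφ, fun z hz => hφM z (hIM (le_idealAdjoin N hN _ hz)), ?_⟩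
  have h0 : φ y⁻ = 0 := hφM _ (hIM (mem_idealAdjoin_self N _))
  have h1 : φ y = φ y⁺ := by
    conv_lhs => rw [← posPart_sub_negPart y]
    rw [hφ.map_sub, h0, sub_zero]
  have h2 : φ y = φ x - ε := by
    rw [hy, hφ.map_sub, hφ.map_smul, hφ.map_unit, mul_one]
  have h3 := hφ.nonneg (posPart_nonneg y)
  linarith

theorem isLatticeIdeal_bot : IsLatticeIdeal (⊥ : Submodule ℝ V) := by
  intro x y h hy
  rw [Submodule.mem_bot] at hy ⊢
  rw [hy, abs_zero] at h
  exact le_antisymm ((le_abs_self x).trans h) (neg_nonpos.1 ((neg_le_abs x).trans h))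

/-- The order of an Archimedean vector lattice with strong unit is determined by its real lattice
homomorphisms. -/
theorem le_of_forall_isLatticeCharacter {u : V} (hu : IsStrongUnit u)
    (harch : ∀ x : V, (∀ ε : ℝ, 0 < ε → x ≤ ε • u) → x ≤ 0) {x y : V}
    (h : ∀ φ, IsLatticeCharacter u φ → φ x ≤ φ y) : x ≤ y := by
  rw [← sub_nonpos]
  refine harch _ fun ε hε => ?_
  by_contra hcon
  obtain ⟨φ, hφ, -, hεφ⟩ := exists_isLatticeCharacter hu isLatticeIdeal_bot
    (x := x - y) (ε := ε) (by
      rw [Submodule.mem_bot, posPart_eq_zero, sub_nonpos]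
      exact hcon)
  have := h φ hφ
  rw [hφ.map_sub] at hεφ
  linarith

end VectorLattice

/-! ### Kakutani representation, functional calculus and Jensen's inequality. -/

section FunctionalCalculus

variable {V : Type*} [AddCommGroup V] [Lattice V] [IsOrderedAddMonoid V] [Module ℝ V]
  [IsOrderedModule ℝ V]

/-- Tychonoff: the defining equations are closed for pointwise convergence, and `|x| ≤ k x • u`
confines `φ x` to `[-k x, k x]`. -/
theorem isCompact_setOf_isLatticeCharacter {u : V} (hu : IsStrongUnit u) :
    IsCompact {φ : V → ℝ | IsLatticeCharacter u φ} := by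
  choose k hk hxk using hu.2
  refine (isCompact_univ_pi fun x => isCompact_Icc (a := -k x) (b := k x)).of_isClosed_subset
    ?_ ?_
  · have e : {φ : V → ℝ | IsLatticeCharacter u φ} =
        (⋂ (x) (y), {φ : V → ℝ | φ (x + y) = φ x + φ y}) ∩
        (⋂ (c : ℝ) (x), {φ : V → ℝ | φ (c • x) = c * φ x}) ∩
        (⋂ x, {φ : V → ℝ | φ |x| = |φ x|}) ∩ {φ : V → ℝ | φ u = 1} := by
      ext φ
      simp only [Set.mem_inter_iff, Set.mem_iInter]
      exact ⟨fun h => ⟨⟨⟨h.1, h.2⟩, h.3⟩, h.4⟩, fun h => ⟨h.1.1.1, h.1.1.2, h.1.2, h.2⟩⟩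
    rw [e]
    refine IsClosed.inter (IsClosed.inter (IsClosed.inter ?_ ?_) ?_) ?_
    · exact isClosed_iInter fun x => isClosed_iInter fun y =>
        isClosed_eq (by fun_prop) (by fun_prop)
    · exact isClosed_iInter fun c => isClosed_iInter fun x =>
        isClosed_eq (by fun_prop) (by fun_prop)
    · exact isClosed_iInter fun x => isClosed_eq (by fun_prop) (by fun_prop)
    · exact isClosed_eq (by fun_prop) (by fun_prop)
  · intro φ hφ x _
    have h1 : |φ x| ≤ k x := by
      have h1 := IsLatticeCharacter.mono hφ (hxk x)
      rwa [IsLatticeCharacter.map_abs hφ, IsLatticeCharacter.map_smul hφ,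
        IsLatticeCharacter.map_unit hφ, mul_one] at h1
    exact abs_le.1 h1

theorem IsLatticeCharacter.map_sup {u : V} {φ : V → ℝ} (h : IsLatticeCharacter u φ) (x y : V) :
    φ (x ⊔ y) = φ x ⊔ φ y := by
  have e : (2 : ℝ) • (x ⊔ y) = x + y + |y - x| := by
    rw [two_smul, ← two_nsmul, two_nsmul_sup_eq_add_add_abs_sub]
  have h1 := congrArg φ e
  rw [h.map_smul, h.map_add, h.map_add, h.map_abs, h.map_sub,
    ← two_nsmul_sup_eq_add_add_abs_sub, nsmul_eq_mul] at h1
  push_cast at h1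
  linarith

theorem IsLatticeCharacter.map_inf {u : V} {φ : V → ℝ} (h : IsLatticeCharacter u φ) (x y : V) :
    φ (x ⊓ y) = φ x ⊓ φ y := by
  have e : x ⊓ y = x + y - (x ⊔ y) := by rw [← inf_add_sup x y, add_sub_cancel_right]
  rw [e, h.map_sub, h.map_add, h.map_sup, ← inf_add_sup (φ x), add_sub_cancel_right]

/-- Continuous functions on the space of real lattice homomorphisms of a uniformly complete
Archimedean vector lattice with strong unit are evaluations. -/
theorem exists_eval_eq {u : V} (hu : IsStrongUnit u)
    (harch : ∀ x : V, (∀ ε : ℝ, 0 < ε → x ≤ ε • u) → x ≤ 0)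
    (hcomp : ∀ s : ℕ → V, (∀ N n m, N ≤ n → N ≤ m → |s n - s m| ≤ ((1 / 2 : ℝ) ^ N) • u) →
      ∃ x, ∀ n, |s n - x| ≤ ((1 / 2 : ℝ) ^ n) • u)
    (g : C({φ : V → ℝ | IsLatticeCharacter u φ}, ℝ)) :
    ∃ w : V, ∀ φ, φ.1 w = g φ := by
  have : CompactSpace {φ : V → ℝ | IsLatticeCharacter u φ} :=
    isCompact_iff_compactSpace.1 (isCompact_setOf_isLatticeCharacter hu)
  let ev : V → C({φ : V → ℝ | IsLatticeCharacter u φ}, ℝ) := fun x =>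
    ⟨fun φ => φ.1 x, (continuous_apply x).comp continuous_subtype_val⟩
  -- Lattice form of Stone–Weierstrass. Values at two distinct points are interpolated by a
  -- combination of a separating element and `u`.
  have hdense : closure (Set.range ev) = ⊤ := by
    refine ContinuousMap.sublattice_closure_eq_top _ ⟨_, u, rfl⟩ ?_ ?_ ?_
    · rintro _ ⟨x, rfl⟩ _ ⟨y, rfl⟩
      exact ⟨x ⊓ y, ContinuousMap.ext fun φ => IsLatticeCharacter.map_inf φ.2 x y⟩
    · rintro _ ⟨x, rfl⟩ _ ⟨y, rfl⟩
      exact ⟨x ⊔ y, ContinuousMap.ext fun φ => IsLatticeCharacter.map_sup φ.2 x y⟩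
    · intro v φ ψ
      have lin : ∀ (χ : {φ : V → ℝ | IsLatticeCharacter u φ}) (a b : ℝ) (x : V),
          χ.1 (a • x + b • u) = a * χ.1 x + b := by
        intro χ a b x
        have hχ : IsLatticeCharacter u χ.1 := χ.2
        rw [hχ.map_add, hχ.map_smul, hχ.map_smul, hχ.map_unit, mul_one]
      by_cases hφψ : φ = ψ
      · subst hφψ
        refine ⟨_, ⟨(0 : ℝ) • u + v φ • u, rfl⟩, ?_, ?_⟩ <;>
        · change φ.1 _ = _
          rw [lin]
          ring
      · obtain ⟨x, hx⟩ : ∃ x, φ.1 x ≠ ψ.1 x := by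
          by_contra! h
          exact hφψ (Subtype.ext (funext h))
        have hx' : φ.1 x - ψ.1 x ≠ 0 := sub_ne_zero.2 hx
        set a := (v φ - v ψ) / (φ.1 x - ψ.1 x) with ha
        have ha' : a * (φ.1 x - ψ.1 x) = v φ - v ψ := div_mul_cancel₀ _ hx'
        refine ⟨_, ⟨a • x + (v φ - a * φ.1 x) • u, rfl⟩, ?_, ?_⟩
        · change φ.1 _ = _
          rw [lin]
          ring
        · change ψ.1 _ = _
          rw [lin]
          linarith
  -- The exponent `n + 1` leaves room for two errors to add up to the `(1 / 2) ^ N` required by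
  -- `hcomp`.
  have happrox : ∀ n : ℕ, ∃ x : V, ∀ φ : {φ : V → ℝ | IsLatticeCharacter u φ},
      |φ.1 x - g φ| ≤ (1 / 2 : ℝ) ^ (n + 1) := by
    intro n
    have hg : g ∈ closure (Set.range ev) := by rw [hdense]; trivial
    obtain ⟨_, ⟨x, rfl⟩, hx⟩ := Metric.mem_closure_iff.1 hg ((1 / 2 : ℝ) ^ (n + 1))
      (by positivity)
    refine ⟨x, fun φ => ?_⟩
    have := (ContinuousMap.dist_apply_le_dist (f := g) (g := ev x) φ).trans hx.le
    rwa [dist_comm, Real.dist_eq] at this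
  choose s hs using happrox
  obtain ⟨w, hw⟩ := hcomp s (by
    intro N n m hn hm
    refine le_of_forall_isLatticeCharacter hu harch fun φ hφ => ?_
    rw [hφ.map_abs, hφ.map_sub, hφ.map_smul, hφ.map_unit, mul_one]
    have h1 := hs n ⟨φ, hφ⟩
    have h2 := hs m ⟨φ, hφ⟩
    have h3 : (1 / 2 : ℝ) ^ (n + 1) ≤ (1 / 2 : ℝ) ^ (N + 1) :=
      pow_le_pow_of_le_one (by norm_num) (by norm_num) (by omega)
    have h4 : (1 / 2 : ℝ) ^ (m + 1) ≤ (1 / 2 : ℝ) ^ (N + 1) :=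
      pow_le_pow_of_le_one (by norm_num) (by norm_num) (by omega)
    have h5 : (1 / 2 : ℝ) ^ (N + 1) = (1 / 2 : ℝ) ^ N / 2 := by ring
    simp only [abs_le] at h1 h2 ⊢
    constructor <;> linarith [h1.1, h1.2, h2.1, h2.2])
  refine ⟨w, fun φ => ?_⟩
  have hφ : IsLatticeCharacter u φ.1 := φ.2
  have hlim : Tendsto (fun n : ℕ => 2 * (1 / 2 : ℝ) ^ n) atTop (𝓝 (2 * 0)) :=
    (tendsto_pow_atTop_nhds_zero_of_lt_one (by norm_num) (by norm_num)).const_mul 2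
  have h0 : |φ.1 w - g φ| ≤ 2 * 0 := by
    refine ge_of_tendsto' hlim fun n => ?_
    have h1 := hs n φ
    have h2 := hφ.mono (hw n)
    rw [hφ.map_abs, hφ.map_sub, hφ.map_smul, hφ.map_unit, mul_one] at h2
    have h5 : (1 / 2 : ℝ) ^ (n + 1) = (1 / 2 : ℝ) ^ n / 2 := by ring
    have h6 : (0 : ℝ) < (1 / 2 : ℝ) ^ n := by positivity
    simp only [abs_le] at h1 h2 ⊢
    constructor <;> linarith [h1.1, h1.2, h2.1, h2.2]
  rw [mul_zero] at h0
  exact sub_eq_zero.1 (abs_eq_zero.1 (le_antisymm h0 (abs_nonneg _)))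

/-- Jensen's inequality for the function `a ^ 2 + b ^ 2` and a normalised positive functional. -/
theorem sq_add_sq_le_of_positive {u : V} (hu : IsStrongUnit u)
    (harch : ∀ x : V, (∀ ε : ℝ, 0 < ε → x ≤ ε • u) → x ≤ 0)
    (ω : V →ₗ[ℝ] ℝ) (hω : ∀ x, 0 ≤ x → 0 ≤ ω x) (hω1 : ω u = 1) {x y h : V}
    (hh : ∀ φ, IsLatticeCharacter u φ → φ h = φ x ^ 2 + φ y ^ 2) :
    ω x ^ 2 + ω y ^ 2 ≤ ω h := by
  -- At `φ` this element takes the value `(φ x - ω x)² + (φ y - ω y)²`; applying `ω` gives the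
  -- claim.
  have hd : 0 ≤ h - (2 * ω x) • x - (2 * ω y) • y + (ω x ^ 2 + ω y ^ 2) • u := by
    refine le_of_forall_isLatticeCharacter hu harch fun φ hφ => ?_
    have h0 : φ 0 = 0 := by simpa using hφ.map_smul 0 0
    rw [hφ.map_add, hφ.map_sub, hφ.map_sub, hφ.map_smul, hφ.map_smul, hφ.map_smul, hφ.map_unit,
      hh φ hφ, h0]
    nlinarith [sq_nonneg (φ x - ω x), sq_nonneg (φ y - ω y)]
  have := hω _ hd
  simp only [map_add, map_sub, map_smul, smul_eq_mul, hω1] at this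
  nlinarith

/-- If equality holds in Jensen's inequality, the functional is an evaluation at a point. -/
theorem eval_eq_of_positive {u : V} (hu : IsStrongUnit u)
    (harch : ∀ x : V, (∀ ε : ℝ, 0 < ε → x ≤ ε • u) → x ≤ 0)
    (ω : V →ₗ[ℝ] ℝ) (hω : ∀ x, 0 ≤ x → 0 ≤ ω x) (hω1 : ω u = 1) {x y h w : V}
    (hh : ∀ φ, IsLatticeCharacter u φ → φ h = φ x ^ 2 + φ y ^ 2)
    (hle : ω h ≤ ω x ^ 2 + ω y ^ 2) (G : C(ℝ × ℝ, ℝ))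
    (hw : ∀ φ, IsLatticeCharacter u φ → φ w = G (φ x, φ y)) :
    ω w = G (ω x, ω y) := by
  set a := ω x
  set b := ω y
  -- The squared distance to `(a, b)`. Equality in Jensen's inequality gives `ω d ≤ 0`, so the
  -- measure `ω` is concentrated where `d` vanishes.
  set d := h - (2 * a) • x - (2 * b) • y + (a ^ 2 + b ^ 2) • u with hd
  have hφd : ∀ φ, IsLatticeCharacter u φ → φ d = (φ x - a) ^ 2 + (φ y - b) ^ 2 := by
    intro φ hφ
    rw [hd, hφ.map_add, hφ.map_sub, hφ.map_sub, hφ.map_smul, hφ.map_smul, hφ.map_smul,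
      hφ.map_unit, hh φ hφ]
    ring
  have hωd : ω d ≤ 0 := by
    simp only [hd, map_add, map_sub, map_smul, smul_eq_mul, hω1]
    nlinarith
  obtain ⟨k, hk, hwk⟩ := hu.2 w
  set M := k + |G (a, b)|
  have hM : 0 ≤ M := add_nonneg hk (abs_nonneg _)
  have key : ∀ ε : ℝ, 0 < ε → |ω w - G (a, b)| ≤ ε := by
    intro ε hε
    obtain ⟨δ, hδ, hG⟩ := Metric.continuousAt_iff.1 (G.continuous.continuousAt (x := (a, b))) ε hε
    set C := M / δ ^ 2
    have hC : 0 ≤ C := by positivity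
    -- A Chebyshev bound: near `(a, b)` continuity of `G` gives `ε`; elsewhere `d ≥ δ²`, and `C * d`
    -- exceeds the global bound `M`.
    have hv : |w - G (a, b) • u| ≤ ε • u + C • d := by
      refine le_of_forall_isLatticeCharacter hu harch fun φ hφ => ?_
      rw [hφ.map_abs, hφ.map_sub, hφ.map_add, hφ.map_smul, hφ.map_smul, hφ.map_smul,
        hφ.map_unit, hφd φ hφ, hw φ hφ, mul_one, mul_one]
      by_cases hlt : dist (φ x, φ y) (a, b) < δ
      · have := (hG hlt).le
        rw [Real.dist_eq] at this
        exact this.trans (le_add_of_nonneg_right (by positivity))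
      · have h1 : δ ^ 2 ≤ (φ x - a) ^ 2 + (φ y - b) ^ 2 := by
          rw [not_lt, Prod.dist_eq, le_max_iff, Real.dist_eq, Real.dist_eq] at hlt
          rcases hlt with h | h
          · have := pow_le_pow_left₀ hδ.le h 2
            rw [sq_abs] at this
            nlinarith [sq_nonneg (φ y - b)]
          · have := pow_le_pow_left₀ hδ.le h 2
            rw [sq_abs] at this
            nlinarith [sq_nonneg (φ x - a)]
        have h2 : |G (φ x, φ y)| ≤ k := by
          have := hφ.mono hwk
          rwa [hφ.map_abs, hφ.map_smul, hφ.map_unit, mul_one, hw φ hφ] at this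
        have h3 : |G (φ x, φ y) - G (a, b)| ≤ M := (abs_sub _ _).trans (add_le_add h2 le_rfl)
        have h4 : M = C * δ ^ 2 := (div_mul_cancel₀ _ (by positivity)).symm
        have h5 : C * δ ^ 2 ≤ C * ((φ x - a) ^ 2 + (φ y - b) ^ 2) :=
          mul_le_mul_of_nonneg_left h1 hC
        linarith
    have mono : ∀ p q : V, p ≤ q → ω p ≤ ω q := fun p q hpq => by
      have := hω _ (sub_nonneg.2 hpq)
      rw [map_sub] at this
      linarith
    have h1 := mono _ _ ((le_abs_self _).trans hv)
    have h2 := mono _ _ ((neg_le_abs _).trans hv)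
    simp only [map_add, map_sub, map_neg, map_smul, smul_eq_mul, hω1, mul_one] at h1 h2
    rw [abs_le]
    have h3 : C * ω d ≤ 0 := mul_nonpos_of_nonneg_of_nonpos hC hωd
    constructor <;> linarith
  exact sub_eq_zero.1 (abs_eq_zero.1 (le_antisymm (le_of_forall_pos_le_add (by simpa using key))
    (abs_nonneg _)))

end FunctionalCalculus

/-! ### Order-continuous norms and principal ideals. -/

section BanachLattice

variable {E : Type*} [NormedAddCommGroup E] [Lattice E] [HasSolidNorm E]
  [IsOrderedAddMonoid E] [NormedSpace ℝ E] [IsOrderedModule ℝ E] [CompleteSpace E]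

theorem le_zero_of_forall_le_smul {x u : E} (h : ∀ ε : ℝ, 0 < ε → x ≤ ε • u) : x ≤ 0 := by
  have hlim : Tendsto (fun ε : ℝ => ε • u) (𝓝[>] 0) (𝓝 ((0 : ℝ) • u)) :=
    ((continuous_id.smul continuous_const).tendsto 0).mono_left nhdsWithin_le_nhds
  rw [zero_smul] at hlim
  exact ge_of_tendsto hlim (eventually_mem_nhdsWithin.mono fun ε hε => h ε hε)

/-- In a Banach lattice with order-continuous norm, upward directed order bounded sets have a
supremum, which lies in their norm closure. -/
theorem HasOrderContinuousNorm.exists_isLUB (hE : HasOrderContinuousNorm E) {D : Set E}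
    (hne : D.Nonempty) (hdir : DirectedOn (· ≤ ·) D) (hb : BddAbove D) :
    ∃ s ∈ closure D, IsLUB D s := by
  -- Gaps between upper bounds and elements of `D`. No supremum is available yet, but `inf A = 0`
  -- can be shown without one.
  set A : Set E := {a | ∃ v ∈ upperBounds D, ∃ d ∈ D, a = v - d} with hA
  have hsmall : ∀ ε : ℝ, 0 < ε → ∃ v ∈ upperBounds D, ∃ d ∈ D, ‖v - d‖ < ε := by
    intro ε hε
    suffices h : A.Nonempty ∧ DirectedOn (fun a b : E => b ≤ a) A ∧ IsGLB A 0 by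
      obtain ⟨_, ⟨v, hv, d, hd, rfl⟩, h⟩ := hE A h.1 h.2.1 h.2.2 ε hε
      exact ⟨v, hv, d, hd, h⟩
    refine ⟨?_, ?_, ?_⟩
    · obtain ⟨v, hv⟩ := hb
      obtain ⟨d, hd⟩ := hne
      exact ⟨_, v, hv, d, hd, rfl⟩
    · rintro _ ⟨v, hv, d, hd, rfl⟩ _ ⟨v', hv', d', hd', rfl⟩
      obtain ⟨d'', hd'', h, h'⟩ := hdir d hd d' hd'
      exact ⟨_, ⟨v ⊓ v', fun x hx => le_inf (hv hx) (hv' hx), d'', hd'', rfl⟩,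
        sub_le_sub inf_le_left h, sub_le_sub inf_le_right h'⟩
    · refine ⟨?_, fun b hb' => ?_⟩
      · rintro _ ⟨v, hv, d, hd, rfl⟩
        exact sub_nonneg.2 (hv hd)
      · have hstep : ∀ v ∈ upperBounds D, v - b ∈ upperBounds D := by
          intro v hv d hd
          have := hb' ⟨v, hv, d, hd, rfl⟩
          rw [le_sub_iff_add_le] at this ⊢
          rwa [add_comm]
        obtain ⟨v, hv⟩ := hb
        obtain ⟨d, hd⟩ := hne
        have hn : ∀ n : ℕ, v - (n : ℝ) • b ∈ upperBounds D := by
          intro n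
          induction n with
          | zero => simpa using hv
          | succ n ih =>
            have e : v - ((n + 1 : ℕ) : ℝ) • b = v - (n : ℝ) • b - b := by
              push_cast
              module
            rw [e]
            exact hstep _ ih
        have hvd : 0 ≤ v - d := sub_nonneg.2 (hv hd)
        refine le_zero_of_forall_le_smul (u := v - d) fun ε hε => ?_
        obtain ⟨n, hnε⟩ := exists_nat_gt ε⁻¹
        have hn0 : (0 : ℝ) < n := (inv_pos.2 hε).trans hnε
        have h1 : (n : ℝ) • b ≤ v - d := by
          have := hn n hd
          rw [le_sub_iff_add_le] at this ⊢
          rwa [add_comm]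
        have h2 := smul_le_smul_of_nonneg_left h1 (inv_nonneg.2 hn0.le)
        rw [inv_smul_smul₀ hn0.ne'] at h2
        refine h2.trans (smul_le_smul_of_nonneg_right ?_ hvd)
        exact inv_le_of_inv_le₀ hε hnε.le
  choose v hv d hd hvd using fun n : ℕ => hsmall (1 / ((n : ℝ) + 1)) (by positivity)
  have hlim := tendsto_one_div_add_atTop_nhds_zero_nat (𝕜 := ℝ)
  have hcau : CauchySeq d := by
    refine cauchySeq_of_le_tendsto_0 (fun N : ℕ => 2 * (1 / ((N : ℝ) + 1))) ?_ ?_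
    · intro n m N hn hm
      -- Every `d` lies below every `v`, so two elements differ by at most the sum of their gaps.
      have h1 : |d n - d m| ≤ |(v m - d m) + (v n - d n)| := by
        have p := sub_nonneg.2 (hv m (hd m))
        have q := sub_nonneg.2 (hv n (hd n))
        rw [abs_of_nonneg (add_nonneg p q)]
        refine abs_le'.2 ⟨?_, ?_⟩
        · exact (sub_le_sub_right (hv m (hd n)) _).trans (le_add_of_nonneg_right q)
        · rw [neg_sub]
          exact (sub_le_sub_right (hv n (hd m)) _).trans (le_add_of_nonneg_left p)
      rw [dist_eq_norm]
      refine (norm_le_norm_of_abs_le_abs h1).trans ((norm_add_le _ _).trans ?_)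
      have hn' : (1 : ℝ) / (n + 1) ≤ 1 / (N + 1) := by gcongr
      have hm' : (1 : ℝ) / (m + 1) ≤ 1 / (N + 1) := by gcongr
      linarith [hvd n, hvd m]
    · simpa using hlim.const_mul 2
  obtain ⟨s, hs⟩ := cauchySeq_tendsto_of_complete hcau
  have hvs : Tendsto v atTop (𝓝 s) := by
    have h0 : Tendsto (fun n => v n - d n) atTop (𝓝 0) :=
      squeeze_zero_norm (fun n => (hvd n).le) hlim
    simpa using h0.add hs
  refine ⟨s, mem_closure_of_tendsto hs (Eventually.of_forall hd), ?_, ?_⟩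
  · intro x hx
    exact ge_of_tendsto' hvs fun n => hv n hx
  · intro b hb'
    exact le_of_tendsto' hs fun n => hb' (hd n)

/-- Decreasing positive sequences converge in norm. -/
theorem HasOrderContinuousNorm.exists_tendsto_of_antitone (hE : HasOrderContinuousNorm E)
    {a : ℕ → E} (ha : Antitone a) (ha0 : ∀ n, 0 ≤ a n) : ∃ l, Tendsto a atTop (𝓝 l) := by
  have hmono : Monotone fun n => -a n := fun n m h => neg_le_neg (ha h)
  obtain ⟨s, hs, hlub⟩ := hE.exists_isLUB (D := Set.range fun n => -a n) (Set.range_nonempty _)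
    (directedOn_range.2 hmono.directed_le)
    ⟨0, by rintro _ ⟨n, rfl⟩; exact neg_nonpos.2 (ha0 n)⟩
  refine ⟨-s, Metric.tendsto_atTop.2 fun ε hε => ?_⟩
  obtain ⟨_, ⟨n, rfl⟩, hn⟩ := Metric.mem_closure_iff.1 hs ε hε
  refine ⟨n, fun m hm => lt_of_le_of_lt ?_ hn⟩
  have h0 : ∀ k, 0 ≤ a k - -s := fun k => by
    have := hlub.1 ⟨k, rfl⟩
    rwa [sub_neg_eq_add, ← neg_le_iff_add_nonneg']
  rw [dist_eq_norm, dist_comm, dist_eq_norm]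
  have e : ‖-a n - s‖ = ‖a n - -s‖ := by
    rw [← norm_neg]
    congr 1
    abel
  simp only [e]
  exact BLComplexification.norm_mono_of_nonneg (h0 m) (sub_le_sub_right (ha hm) _)

/-- The ideal generated by `u`. -/
def principalIdeal (u : E) : Submodule ℝ E where
  carrier := {x | ∃ c : ℝ, 0 ≤ c ∧ |x| ≤ c • u}
  zero_mem' := ⟨0, le_rfl, by simp⟩
  add_mem' := by
    rintro a b ⟨c, hc, h⟩ ⟨c', hc', h'⟩
    refine ⟨c + c', add_nonneg hc hc', (abs_add_le a b).trans ?_⟩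
    rw [add_smul]
    exact add_le_add h h'
  smul_mem' := by
    rintro r a ⟨c, hc, h⟩
    refine ⟨|r| * c, mul_nonneg (abs_nonneg r) hc, ?_⟩
    rw [abs_real_smul, mul_smul]
    exact smul_le_smul_of_nonneg_left h (abs_nonneg r)

theorem isLatticeIdeal_principalIdeal (u : E) : IsLatticeIdeal (principalIdeal u) := by
  rintro x y h ⟨c, hc, h'⟩
  exact ⟨c, hc, h.trans h'⟩

theorem IsLatticeIdeal.sup_mem {N : Submodule ℝ E} (hN : IsLatticeIdeal N) {x y : E}
    (hx : x ∈ N) (hy : y ∈ N) : x ⊔ y ∈ N := by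
  refine hN.mem_of_abs_le (y := |x| + |y|) (abs_le'.2 ⟨?_, ?_⟩)
    (N.add_mem (hN.abs_mem hx) (hN.abs_mem hy))
  · exact sup_le ((le_abs_self x).trans (le_add_of_nonneg_right (abs_nonneg y)))
      ((le_abs_self y).trans (le_add_of_nonneg_left (abs_nonneg x)))
  · rw [neg_sup]
    exact inf_le_left.trans ((neg_le_abs x).trans (le_add_of_nonneg_right (abs_nonneg y)))

theorem IsLatticeIdeal.inf_mem {N : Submodule ℝ E} (hN : IsLatticeIdeal N) {x y : E}
    (hx : x ∈ N) (hy : y ∈ N) : x ⊓ y ∈ N := by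
  have := N.neg_mem (hN.sup_mem (N.neg_mem hx) (N.neg_mem hy))
  rwa [neg_sup, neg_neg, neg_neg] at this

instance (u : E) : Lattice (principalIdeal u) :=
  Subtype.lattice (fun _ _ hx hy => (isLatticeIdeal_principalIdeal u).sup_mem hx hy)
    (fun _ _ hx hy => (isLatticeIdeal_principalIdeal u).inf_mem hx hy)

instance (u : E) : IsOrderedAddMonoid (principalIdeal u) where
  add_le_add_left _ _ h c := add_le_add_left (α := E) h c

instance (u : E) : IsOrderedModule ℝ (principalIdeal u) where
  smul_le_smul_of_nonneg_left _ hc _ _ h := smul_le_smul_of_nonneg_left (α := ℝ) (β := E) h hc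
  smul_le_smul_of_nonneg_right x hx _ _ h :=
    smul_le_smul_of_nonneg_right (α := ℝ) (β := E) h (show (0 : E) ≤ x from hx)

theorem self_mem_principalIdeal {u : E} (hu : 0 ≤ u) : u ∈ principalIdeal u :=
  ⟨1, zero_le_one, by rw [abs_of_nonneg hu, one_smul]⟩

/-- The generator of a principal ideal. -/
def principalIdealUnit {u : E} (hu : 0 ≤ u) : principalIdeal u := ⟨u, self_mem_principalIdeal hu⟩

theorem isStrongUnit_principalIdealUnit {u : E} (hu : 0 ≤ u) :
    IsStrongUnit (principalIdealUnit hu) :=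
  ⟨hu, fun x => x.2⟩

theorem principalIdeal_archimedean {u : E} (hu : 0 ≤ u) (x : principalIdeal u)
    (h : ∀ ε : ℝ, 0 < ε → x ≤ ε • principalIdealUnit hu) : x ≤ 0 :=
  le_zero_of_forall_le_smul (x := (x : E)) (u := u) fun ε hε => h ε hε

/-- Such a sequence is Cauchy in norm. The order estimates pass to the norm limit because the cone
is closed, and they put the limit back in the ideal. -/
theorem principalIdeal_complete {u : E} (hu : 0 ≤ u) (s : ℕ → principalIdeal u)
    (hs : ∀ N n m, N ≤ n → N ≤ m → |s n - s m| ≤ ((1 / 2 : ℝ) ^ N) • principalIdealUnit hu) :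
    ∃ x, ∀ n, |s n - x| ≤ ((1 / 2 : ℝ) ^ n) • principalIdealUnit hu := by
  have hs' : ∀ N n m, N ≤ n → N ≤ m → |(s n : E) - s m| ≤ ((1 / 2 : ℝ) ^ N) • u := hs
  have hcau : CauchySeq fun n => (s n : E) := by
    refine cauchySeq_of_le_tendsto_0 (fun N : ℕ => (1 / 2 : ℝ) ^ N * ‖u‖) ?_ ?_
    · intro n m N hn hm
      have h := hs' N n m hn hm
      rw [dist_eq_norm]
      refine (norm_le_norm_of_abs_le_abs (h.trans (le_abs_self _))).trans (le_of_eq ?_)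
      rw [norm_smul, Real.norm_of_nonneg (by positivity)]
    · simpa using (tendsto_pow_atTop_nhds_zero_of_lt_one (by norm_num)
        (by norm_num : (1 / 2 : ℝ) < 1)).mul_const ‖u‖
  obtain ⟨x, hx⟩ := cauchySeq_tendsto_of_complete hcau
  have hbound : ∀ n, |(s n : E) - x| ≤ ((1 / 2 : ℝ) ^ n) • u := by
    intro n
    refine abs_le'.2 ⟨?_, ?_⟩
    · exact le_of_tendsto (tendsto_const_nhds.sub hx) ((eventually_ge_atTop n).mono fun m hm =>
        (le_abs_self _).trans (hs' n n m le_rfl hm))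
    · exact le_of_tendsto (tendsto_const_nhds.sub hx).neg ((eventually_ge_atTop n).mono
        fun m hm => (neg_le_abs _).trans (hs' n n m le_rfl hm))
  have hxmem : x ∈ principalIdeal u := by
    have h1 : x - s 0 ∈ principalIdeal u :=
      ⟨(1 / 2 : ℝ) ^ 0, by positivity, by rw [abs_sub_comm]; exact hbound 0⟩
    have := (principalIdeal u).add_mem h1 (s 0).2
    rwa [sub_add_cancel] at this
  exact ⟨⟨x, hxmem⟩, hbound⟩

end BanachLattice

/-! ### Cesàro limits of positive operators and the null ideal. -/

section PositiveOperators

variable {E : Type*} [NormedAddCommGroup E] [Lattice E] [HasSolidNorm E]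
  [IsOrderedAddMonoid E] [NormedSpace ℝ E] [IsOrderedModule ℝ E] [CompleteSpace E]

/-- The Cesàro means of `T` converge strongly to `P`. -/
def IsCesaroLimit (T P : E →L[ℝ] E) : Prop :=
  ∀ x : E, Tendsto (fun n : ℕ => (n : ℝ)⁻¹ • ∑ k ∈ Finset.range n, (T ^ k) x) atTop (𝓝 (P x))

/-- With Cesàro means `A_n`, one has `T^n x / n = (1 + 1/n) A_{n+1} x - A_n x`. -/
theorem IsCesaroLimit.tendsto_inv_smul_pow {T P : E →L[ℝ] E} (h : IsCesaroLimit T P) (x : E) :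
    Tendsto (fun n : ℕ => (n : ℝ)⁻¹ • (T ^ n) x) atTop (𝓝 0) := by
  have h1 := (h x).comp (tendsto_add_atTop_nat 1)
  have hc : Tendsto (fun n : ℕ => 1 + 1 / (n : ℝ)) atTop (𝓝 (1 + 0)) :=
    tendsto_one_div_atTop_nhds_zero_nat.const_add 1
  have h2 := (hc.smul h1).sub (h x)
  rw [add_zero, one_smul, sub_self] at h2
  refine h2.congr' ?_
  filter_upwards [eventually_gt_atTop 0] with n hn
  have hn' : (n : ℝ) ≠ 0 := by exact_mod_cast hn.ne'
  have hn'' : (n : ℝ) + 1 ≠ 0 := by positivity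
  simp only [Function.comp_apply, Nat.cast_add, Nat.cast_one, smul_smul]
  have e : (1 + 1 / (n : ℝ)) * ((n : ℝ) + 1)⁻¹ = (n : ℝ)⁻¹ := by
    field_simp
  rw [e, Finset.sum_range_succ, smul_add, add_sub_cancel_left]

/-- The means telescope: `A_n (T x) = A_n x + (T^n x - x) / n`. -/
theorem IsCesaroLimit.apply_map {T P : E →L[ℝ] E} (h : IsCesaroLimit T P) (x : E) :
    P (T x) = P x := by
  refine tendsto_nhds_unique (h (T x)) ?_
  have h1 := (h x).add ((h.tendsto_inv_smul_pow x).sub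
    ((tendsto_inv_atTop_nhds_zero_nat (𝕜 := ℝ)).smul_const x))
  rw [zero_smul, sub_zero, add_zero] at h1
  refine h1.congr fun n => ?_
  rw [← smul_sub, ← smul_add]
  congr 1
  have e : ∀ k, (T ^ k) (T x) = (T ^ (k + 1)) x := fun k => by rw [pow_succ]; rfl
  simp only [e]
  have := Finset.sum_range_succ (fun k => (T ^ k) x) n
  rw [Finset.sum_range_succ'] at this
  simp only [pow_zero, one_apply_eq_self] at this
  rw [← add_sub_assoc, ← this, add_sub_cancel_right]

theorem IsCesaroLimit.map_apply {T P : E →L[ℝ] E} (h : IsCesaroLimit T P) (x : E) :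
    T (P x) = P x := by
  refine (tendsto_nhds_unique (((T.continuous.tendsto _).comp (h x)).congr fun n => ?_)
    (h (T x))).trans (h.apply_map x)
  have e : ∀ k, (T ^ k) (T x) = T ((T ^ k) x) := fun k => by
    change (T ^ k * T) x = (T * T ^ k) x
    rw [← pow_succ, pow_succ']
  simp only [Function.comp_apply, map_smul, map_sum, e]

theorem IsCesaroLimit.le_apply_of_forall_le {T P : E →L[ℝ] E} (h : IsCesaroLimit T P)
    {x y : E} (hl : ∀ k, x ≤ (T ^ k) y) : x ≤ P y := by
  refine ge_of_tendsto (h y) ((eventually_gt_atTop 0).mono fun n hn => ?_)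
  have hn' : (0 : ℝ) < n := by exact_mod_cast hn
  rw [le_inv_smul_iff_of_pos hn']
  have := Finset.card_nsmul_le_sum (Finset.range n) (fun k => (T ^ k) y) x fun k _ => hl k
  rwa [Finset.card_range, ← Nat.cast_smul_eq_nsmul ℝ] at this

theorem IsCesaroLimit.apply_eq_self {T P : E →L[ℝ] E} (h : IsCesaroLimit T P) {x : E}
    (hx : T x = x) : P x = x := by
  have hk : ∀ k, (T ^ k) x = x := by
    intro k
    induction k with
    | zero => rfl
    | succ k ih => rw [pow_succ, mul_apply_eq_comp, hx, ih]
  refine tendsto_nhds_unique (h x) (tendsto_const_nhds.congr' ?_)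
  filter_upwards [eventually_gt_atTop 0] with n hn
  have hn' : (n : ℝ) ≠ 0 := by exact_mod_cast hn.ne'
  simp only [hk, Finset.sum_const, Finset.card_range, ← Nat.cast_smul_eq_nsmul ℝ]
  rw [inv_smul_smul₀ hn']

theorem map_mono_of_positive {T : E →L[ℝ] E} (hT : ∀ x, 0 ≤ x → 0 ≤ T x) {x y : E}
    (h : x ≤ y) : T x ≤ T y := by
  have := hT _ (sub_nonneg.2 h)
  rwa [map_sub, sub_nonneg] at this

theorem pow_nonneg_of_positive {T : E →L[ℝ] E} (hT : ∀ x, 0 ≤ x → 0 ≤ T x) {x : E}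
    (hx : 0 ≤ x) (k : ℕ) : 0 ≤ (T ^ k) x := by
  induction k with
  | zero => exact hx
  | succ k ih =>
    rw [pow_succ', mul_apply_eq_comp]
    exact hT _ ih

theorem abs_map_le_of_positive {T : E →L[ℝ] E} (hT : ∀ x, 0 ≤ x → 0 ≤ T x) (x : E) :
    |T x| ≤ T |x| := by
  refine abs_le'.2 ⟨map_mono_of_positive hT (le_abs_self x), ?_⟩
  rw [← map_neg]
  exact map_mono_of_positive hT (neg_le_abs x)

theorem IsCesaroLimit.positive {T P : E →L[ℝ] E} (h : IsCesaroLimit T P)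
    (hT : ∀ x, 0 ≤ x → 0 ≤ T x) (x : E) (hx : 0 ≤ x) : 0 ≤ P x :=
  h.le_apply_of_forall_le fun k => pow_nonneg_of_positive hT hx k

theorem IsCesaroLimit.le_apply {T P : E →L[ℝ] E} (h : IsCesaroLimit T P)
    (hT : ∀ x, 0 ≤ x → 0 ≤ T x) {x : E} (hx : x ≤ T x) : x ≤ P x := by
  refine h.le_apply_of_forall_le fun k => ?_
  induction k with
  | zero => exact le_rfl
  | succ k ih =>
    rw [pow_succ', mul_apply_eq_comp]
    exact hx.trans (map_mono_of_positive hT ih)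

/-- The null ideal `{x | P |x| = 0}` of a positive operator `P`. -/
def nullIdeal (P : E →L[ℝ] E) (hP : ∀ x, 0 ≤ x → 0 ≤ P x) : Submodule ℝ E where
  carrier := {x | P |x| = 0}
  zero_mem' := by simp
  add_mem' := by
    intro a b ha hb
    refine le_antisymm ((map_mono_of_positive hP (abs_add_le a b)).trans ?_) (hP _ (abs_nonneg _))
    rw [Set.mem_ofPred_eq] at ha hb
    rw [map_add, ha, hb, add_zero]
  smul_mem' := by
    intro c x hx
    rw [Set.mem_ofPred_eq] at hx ⊢
    rw [abs_real_smul, map_smul, hx, smul_zero]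

theorem mem_nullIdeal {P : E →L[ℝ] E} {hP : ∀ x, 0 ≤ x → 0 ≤ P x} {x : E} :
    x ∈ nullIdeal P hP ↔ P |x| = 0 :=
  Iff.rfl

theorem isLatticeIdeal_nullIdeal (P : E →L[ℝ] E) (hP : ∀ x, 0 ≤ x → 0 ≤ P x) :
    IsLatticeIdeal (nullIdeal P hP) := by
  intro x y h hy
  rw [mem_nullIdeal] at hy ⊢
  exact le_antisymm ((map_mono_of_positive hP h).trans hy.le) (hP _ (abs_nonneg x))

theorem isClosed_nullIdeal (P : E →L[ℝ] E) (hP : ∀ x, 0 ≤ x → 0 ≤ P x) :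
    IsClosed (nullIdeal P hP : Set E) := by
  have hc : Continuous fun x : E => P |x| := by
    have : (fun x : E => P |x|) = fun x => P (x ⊔ -x) := rfl
    rw [this]
    exact P.continuous.comp (continuous_id.sup continuous_neg)
  exact isClosed_eq hc continuous_const

theorem IsCesaroLimit.map_mem_nullIdeal {T P : E →L[ℝ] E} (h : IsCesaroLimit T P)
    (hT : ∀ x, 0 ≤ x → 0 ≤ T x) {x : E} (hx : x ∈ nullIdeal P (h.positive hT)) :
    T x ∈ nullIdeal P (h.positive hT) := by
  rw [mem_nullIdeal] at hx ⊢
  refine le_antisymm ((map_mono_of_positive (h.positive hT) (abs_map_le_of_positive hT x)).trans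
    ?_) (h.positive hT _ (abs_nonneg _))
  rw [h.apply_map, hx]

/-- Below a fixed vector, the null ideal has a largest element. -/
theorem HasOrderContinuousNorm.exists_greatest (hE : HasOrderContinuousNorm E)
    {N : Submodule ℝ E} (hN : IsLatticeIdeal N) (hclosed : IsClosed (N : Set E)) {b : E}
    (hb : 0 ≤ b) : ∃ v ∈ N, 0 ≤ v ∧ v ≤ b ∧ ∀ a ∈ N, 0 ≤ a → a ≤ b → a ≤ v := by
  have hdir : DirectedOn (· ≤ ·) {a | a ∈ N ∧ 0 ≤ a ∧ a ≤ b} := by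
    rintro x ⟨hx, hx0, hxb⟩ y ⟨hy, hy0, hyb⟩
    exact ⟨x ⊔ y, ⟨hN.sup_mem hx hy, hx0.trans le_sup_left, sup_le hxb hyb⟩, le_sup_left,
      le_sup_right⟩
  obtain ⟨v, hv, hlub⟩ := hE.exists_isLUB (D := {a | a ∈ N ∧ 0 ≤ a ∧ a ≤ b})
    ⟨0, N.zero_mem, le_rfl, hb⟩ hdir ⟨b, fun a ha => ha.2.2⟩
  exact ⟨v, closure_minimal (fun a ha => ha.1) hclosed hv,
    hlub.1 ⟨N.zero_mem, le_rfl, hb⟩, hlub.2 fun a ha => ha.2.2,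
    fun a ha ha0 hab => hlub.1 ⟨ha, ha0, hab⟩⟩

/-- The powers of `T` tend to zero on subinvariant positive vectors of the null ideal. -/
theorem IsCesaroLimit.tendsto_pow_zero {T P : E →L[ℝ] E} (h : IsCesaroLimit T P)
    (hE : HasOrderContinuousNorm E) (hT : ∀ x, 0 ≤ x → 0 ≤ T x) {v : E} (hv : 0 ≤ v)
    (hTv : T v ≤ v) (hPv : P v = 0) : Tendsto (fun k => (T ^ k) v) atTop (𝓝 0) := by
  have hanti : Antitone fun k => (T ^ k) v := by
    refine antitone_nat_of_succ_le fun k => ?_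
    induction k with
    | zero => simpa using hTv
    | succ k ih =>
      have e : ∀ j, (T ^ (j + 1)) v = T ((T ^ j) v) := fun j => by
        rw [pow_succ', mul_apply_eq_comp]
      rw [e (k + 1)]
      exact (map_mono_of_positive hT ih).trans (e k).ge
  obtain ⟨l, hl⟩ := hE.exists_tendsto_of_antitone hanti fun k => pow_nonneg_of_positive hT hv k
  have hTl : T l = l := by
    refine tendsto_nhds_unique (((T.continuous.tendsto _).comp hl).congr fun k => ?_)
      (hl.comp (tendsto_add_atTop_nat 1))
    simp only [Function.comp_apply, pow_succ', mul_apply_eq_comp]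
  have hl0 : 0 ≤ l := ge_of_tendsto' hl fun k => pow_nonneg_of_positive hT hv k
  have hlv : l ≤ v := le_of_tendsto' hl fun k => hanti (Nat.zero_le k)
  -- The limit is a fixed vector below `v`, so `l = P l ≤ P v = 0`.
  have hl1 : l ≤ 0 := by
    rw [← h.apply_eq_self hTl, ← hPv]
    exact map_mono_of_positive (h.positive hT) hlv
  rwa [le_antisymm hl1 hl0] at hl

end PositiveOperators

/-! ### Operators on the complexification and lifting of eigenvectors. -/

namespace BLComplexification

variable {E : Type*} [NormedAddCommGroup E] [Lattice E] [HasSolidNorm E]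
  [IsOrderedAddMonoid E] [NormedSpace ℝ E] [IsOrderedModule ℝ E] [CompleteSpace E]

theorem continuous_re : Continuous (re : BLComplexification E → E) :=
  (LipschitzWith.of_dist_le_mul (K := 1) fun z w => by simpa using dist_re_le z w).continuous

theorem continuous_im : Continuous (im : BLComplexification E → E) :=
  (LipschitzWith.of_dist_le_mul (K := 1) fun z w => by simpa using dist_im_le z w).continuous

theorem continuous_ofReal : Continuous (ofReal : E → BLComplexification E) :=
  (LipschitzWith.of_dist_le_mul (K := 1) fun x y => by
    simpa [ofReal] using dist_le_add (ofReal x) (ofReal y)).continuous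

theorem ofReal_add (x y : E) : ofReal (x + y) = ofReal x + ofReal y := by
  ext <;> simp [ofReal]

theorem ofReal_smul (c : ℝ) (x : E) : ofReal (c • x) = (c : ℂ) • ofReal x := by
  ext
  · rw [smul_re]
    simp [ofReal]
  · rw [smul_im]
    simp [ofReal]

theorem eq_ofReal_add_I_smul (z : BLComplexification E) :
    z = ofReal z.re + Complex.I • ofReal z.im := by
  ext <;> simp [ofReal]

/-- The compression of an operator on the complexification to the real part. -/
noncomputable def realPart (T : BLComplexification E →L[ℂ] BLComplexification E) : E →L[ℝ] E where
  toFun x := (T (ofReal x)).re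
  map_add' x y := by rw [ofReal_add, map_add, add_re]
  map_smul' c x := by
    rw [ofReal_smul, map_smul, smul_re]
    simp
  cont := continuous_re.comp (T.continuous.comp continuous_ofReal)

theorem realPart_apply (T : BLComplexification E →L[ℂ] BLComplexification E) (x : E) :
    realPart T x = (T (ofReal x)).re :=
  rfl

theorem IsPositiveOperator.realPart_nonneg {T : BLComplexification E →L[ℂ] BLComplexification E}
    (hT : IsPositiveOperator T) (x : E) (hx : 0 ≤ x) : 0 ≤ realPart T x := by
  obtain ⟨y, hy, h⟩ := hT x hx
  rw [realPart_apply, h]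
  exact hy

theorem IsPositiveOperator.map_ofReal {T : BLComplexification E →L[ℂ] BLComplexification E}
    (hT : IsPositiveOperator T) (x : E) : T (ofReal x) = ofReal (realPart T x) := by
  have hp : ∀ x : E, 0 ≤ x → T (ofReal x) = ofReal (realPart T x) := by
    intro x hx
    obtain ⟨y, -, h⟩ := hT x hx
    rw [realPart_apply, h]
    rfl
  have e : ofReal x = ofReal x⁺ + (-1 : ℂ) • ofReal x⁻ := by
    conv_lhs => rw [← posPart_sub_negPart x]
    ext <;> simp [ofReal, sub_eq_add_neg]
  have e' : realPart T x = realPart T x⁺ - realPart T x⁻ := by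
    rw [← map_sub, posPart_sub_negPart]
  rw [e, map_add, map_smul, hp _ (posPart_nonneg x), hp _ (negPart_nonneg x), e']
  ext <;> simp [ofReal, sub_eq_add_neg]

theorem IsPositiveOperator.map_eq {T : BLComplexification E →L[ℂ] BLComplexification E}
    (hT : IsPositiveOperator T) (z : BLComplexification E) :
    T z = ⟨realPart T z.re, realPart T z.im⟩ := by
  conv_lhs => rw [eq_ofReal_add_I_smul z]
  rw [map_add, map_smul, hT.map_ofReal, hT.map_ofReal]
  ext <;> simp [ofReal]

theorem IsPositiveOperator.modulus_map_le {T : BLComplexification E →L[ℂ] BLComplexification E}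
    (hT : IsPositiveOperator T) (z : BLComplexification E) :
    modulus (T z) ≤ realPart T (modulus z) := by
  refine modulus_le _ fun θ => ?_
  have e : rot (T z) θ = realPart T (rot z θ) := by
    rw [hT.map_eq]
    simp only [rot, map_add, map_smul]
  rw [e]
  exact map_mono_of_positive hT.realPart_nonneg (rot_le_modulus z θ)

theorem IsPositiveOperator.isCesaroLimit_realPart
    {T P : BLComplexification E →L[ℂ] BLComplexification E} (hT : IsPositiveOperator T)
    (hP : ∀ x, Tendsto (fun n : ℕ => (n : ℂ)⁻¹ • ∑ k ∈ Finset.range n, (T ^ k) x) atTop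
      (𝓝 (P x))) : IsCesaroLimit (realPart T) (realPart P) := by
  intro x
  have hpow : ∀ k, (T ^ k) (ofReal x) = ofReal ((realPart T ^ k) x) := by
    intro k
    induction k with
    | zero => rfl
    | succ k ih =>
      rw [pow_succ', mul_apply_eq_comp, ih, hT.map_ofReal, pow_succ', mul_apply_eq_comp]
  have hsum : ∀ n, ∑ k ∈ Finset.range n, (T ^ k) (ofReal x) =
      ofReal (∑ k ∈ Finset.range n, (realPart T ^ k) x) := by
    intro n
    induction n with
    | zero => rfl
    | succ n ih => rw [Finset.sum_range_succ, Finset.sum_range_succ, ofReal_add, ih, hpow]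
  refine ((continuous_re.tendsto _).comp (hP (ofReal x))).congr fun n => ?_
  rw [Function.comp_apply, hsum]
  have e : ((n : ℂ))⁻¹ = (((n : ℝ)⁻¹ : ℝ) : ℂ) := by push_cast; rfl
  rw [e, ← ofReal_smul]
  rfl

theorem modulus_neg (z : BLComplexification E) : modulus (-z) = modulus z := by
  have := modulus_smul (-1) z
  rwa [neg_one_smul, norm_neg, norm_one, one_smul] at this

theorem modulus_sub_le (z w : BLComplexification E) :
    modulus (z - w) ≤ modulus z + modulus w := by
  rw [sub_eq_add_neg, ← modulus_neg w]
  exact modulus_add_le z (-w)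

theorem modulus_mem {N : Submodule ℝ E} (hN : IsLatticeIdeal N) {z : BLComplexification E}
    (hre : z.re ∈ N) (him : z.im ∈ N) : modulus z ∈ N :=
  hN.mem_of_le (modulus_nonneg z) (modulus_le_add z)
    (N.add_mem (hN.abs_mem hre) (hN.abs_mem him))

/-- An eigenvector modulo the null ideal, dominated by a fixed vector, lifts to an eigenvector. -/
theorem IsPositiveOperator.exists_eigenvector
    {T : BLComplexification E →L[ℂ] BLComplexification E} (hT : IsPositiveOperator T)
    (hE : HasOrderContinuousNorm E) {P : E →L[ℝ] E} (hP : IsCesaroLimit (realPart T) P)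
    {u : E} (hu : 0 ≤ u) (hTu : realPart T u = u) {μ : ℂ} (hμ : ‖μ‖ = 1)
    {w : BLComplexification E} (hwre : w.re ∈ principalIdeal u) (hwim : w.im ∈ principalIdeal u)
    (hre : (T w - μ • w).re ∈ nullIdeal P (hP.positive hT.realPart_nonneg))
    (him : (T w - μ • w).im ∈ nullIdeal P (hP.positive hT.realPart_nonneg)) :
    ∃ y, T y = μ • y ∧ y.re ∈ principalIdeal u ∧ y.im ∈ principalIdeal u ∧
      (y - w).re ∈ nullIdeal P (hP.positive hT.realPart_nonneg) ∧
      (y - w).im ∈ nullIdeal P (hP.positive hT.realPart_nonneg) := by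
  set N := nullIdeal P (hP.positive hT.realPart_nonneg) with hNdef
  have hN : IsLatticeIdeal N := isLatticeIdeal_nullIdeal _ _
  have hμ0 : μ ≠ 0 := by
    rintro rfl
    simp at hμ
  -- Eigenvectors for `μ` are the fixed vectors of `S`, and `|S z| ≤ T |z|` since `‖μ‖ = 1`.
  set S : BLComplexification E →L[ℂ] BLComplexification E := μ⁻¹ • T with hS
  have hSmod : ∀ z, modulus (S z) ≤ realPart T (modulus z) := by
    intro z
    have e : S z = μ⁻¹ • T z := rfl
    rw [e, modulus_smul, norm_inv, hμ, inv_one, one_smul]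
    exact hT.modulus_map_le z
  have hsucc : ∀ k z, (S ^ (k + 1)) z = S ((S ^ k) z) := fun k z => by
    rw [pow_succ', mul_apply_eq_comp]
  have hSpow : ∀ k z, modulus ((S ^ k) z) ≤ (realPart T ^ k) (modulus z) := by
    intro k z
    induction k with
    | zero => exact le_rfl
    | succ k ih =>
      rw [hsucc, pow_succ', mul_apply_eq_comp]
      exact (hSmod _).trans (map_mono_of_positive hT.realPart_nonneg ih)
  obtain ⟨c, hc, hwc⟩ : ∃ c : ℝ, 0 ≤ c ∧ modulus w ≤ c • u := by
    obtain ⟨c, hc, h⟩ := modulus_mem (isLatticeIdeal_principalIdeal u) hwre hwim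
    exact ⟨c, hc, (le_abs_self _).trans h⟩
  have hTcu : realPart T (c • u) = c • u := by rw [map_smul, hTu]
  have hSw : ∀ k, modulus ((S ^ k) w) ≤ c • u := by
    intro k
    induction k with
    | zero => exact hwc
    | succ k ih =>
      rw [hsucc, ← hTcu]
      exact (hSmod _).trans (map_mono_of_positive hT.realPart_nonneg ih)
  have hSdiff : ∀ k, modulus ((S ^ k) w - w) ≤ (2 * c) • u := fun k =>
    (modulus_sub_le _ _).trans ((add_le_add (hSw k) hwc).trans (le_of_eq (by module)))
  have hSmem : ∀ k, modulus ((S ^ k) w - w) ∈ N := by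
    have h1 : modulus (S w - w) ∈ N := by
      have e : S w - w = μ⁻¹ • (T w - μ • w) := by
        rw [smul_sub, inv_smul_smul₀ hμ0]
        rfl
      rw [e, modulus_smul]
      exact N.smul_mem _ (modulus_mem hN hre him)
    intro k
    induction k with
    | zero =>
      have e : (S ^ 0) w - w = 0 := by simp
      rw [e]
      exact modulus_mem hN N.zero_mem N.zero_mem
    | succ k ih =>
      have e : (S ^ (k + 1)) w - w = S ((S ^ k) w - w) + (S w - w) := by
        rw [hsucc, map_sub, sub_add_sub_cancel]
      rw [e]
      refine hN.mem_of_le (modulus_nonneg _) (modulus_add_le _ _) (N.add_mem ?_ h1)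
      exact hN.mem_of_le (modulus_nonneg _) (hSmod _)
        (hP.map_mem_nullIdeal hT.realPart_nonneg ih)
  have hb : 0 ≤ (2 * c) • u := smul_nonneg (by positivity) hu
  -- This single `v` dominates all `S^k w - w`, which lie in `N` and below `(2 * c) • u`. The vector
  -- `T v` meets the same two conditions, so `T v ≤ v`.
  obtain ⟨v, hvN, hv0, hvb, hv⟩ :=
    hE.exists_greatest hN (isClosed_nullIdeal _ _) hb
  have hTv : realPart T v ≤ v := by
    refine hv _ (hP.map_mem_nullIdeal hT.realPart_nonneg hvN) (hT.realPart_nonneg v hv0) ?_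
    have := map_mono_of_positive hT.realPart_nonneg hvb
    rwa [map_smul, hTu] at this
  have hPv : P v = 0 := by
    rw [← abs_of_nonneg hv0]
    exact hvN
  have hlim := hP.tendsto_pow_zero hE hT.realPart_nonneg hv0 hTv hPv
  have hSv : ∀ k, modulus ((S ^ k) w - w) ≤ v := fun k =>
    hv _ (hSmem k) (modulus_nonneg _) (hSdiff k)
  have hcau : CauchySeq fun k => (S ^ k) w := by
    refine cauchySeq_of_le_tendsto_0
      (fun N => ‖(realPart T ^ N) v‖ + ‖(realPart T ^ N) v‖) ?_ ?_
    -- `S^(M+j) w - S^M w = S^M (S^j w - w)` has modulus at most `T^M v`, which tends to zero.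
    · have key : ∀ M n, M ≤ n → dist ((S ^ n) w) ((S ^ M) w) ≤ ‖(realPart T ^ M) v‖ := by
        intro M n hn
        obtain ⟨j, rfl⟩ := Nat.exists_eq_add_of_le hn
        have e : (S ^ (M + j)) w - (S ^ M) w = (S ^ M) ((S ^ j) w - w) := by
          rw [pow_add, mul_apply_eq_comp, map_sub]
        rw [dist_eq_norm, e, norm_def]
        refine norm_mono_of_nonneg (modulus_nonneg _) ((hSpow _ _).trans ?_)
        have h1 := pow_nonneg_of_positive hT.realPart_nonneg (sub_nonneg.2 (hSv j)) M
        rwa [map_sub, sub_nonneg] at h1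
      intro n m M hn hm
      exact (dist_triangle_right _ _ ((S ^ M) w)).trans (add_le_add (key M n hn) (key M m hm))
    · simpa using hlim.norm.add hlim.norm
  obtain ⟨y, hy⟩ := cauchySeq_tendsto_of_complete hcau
  have hSy : S y = y := by
    refine tendsto_nhds_unique (((S.continuous.tendsto _).comp hy).congr fun k => ?_)
      (hy.comp (tendsto_add_atTop_nat 1))
    simp only [Function.comp_apply, hsucc]
  have hdiff : Tendsto (fun k => (S ^ k) w - w) atTop (𝓝 (y - w)) := hy.sub_const w
  have hyre : |(y - w).re| ≤ v := by
    have h1 := (continuous_re.tendsto _).comp hdiff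
    refine abs_le'.2 ⟨le_of_tendsto' h1 fun k => ?_, le_of_tendsto' h1.neg fun k => ?_⟩
    · exact (le_abs_self _).trans ((abs_re_le_modulus _).trans (hSv k))
    · exact (neg_le_abs _).trans ((abs_re_le_modulus _).trans (hSv k))
  have hyim : |(y - w).im| ≤ v := by
    have h1 := (continuous_im.tendsto _).comp hdiff
    refine abs_le'.2 ⟨le_of_tendsto' h1 fun k => ?_, le_of_tendsto' h1.neg fun k => ?_⟩
    · exact (le_abs_self _).trans ((abs_im_le_modulus _).trans (hSv k))
    · exact (neg_le_abs _).trans ((abs_im_le_modulus _).trans (hSv k))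
  have hTy : T y = μ • y := by
    conv_rhs => rw [← hSy]
    exact (smul_inv_smul₀ hμ0 (T y)).symm
  refine ⟨y, hTy, ?_, ?_, hN.mem_of_abs_le hyre hvN, hN.mem_of_abs_le hyim hvN⟩
  · have h1 : (y - w).re ∈ principalIdeal u := ⟨2 * c, by positivity, hyre.trans hvb⟩
    simpa using (principalIdeal u).add_mem h1 hwre
  · have h1 : (y - w).im ∈ principalIdeal u := ⟨2 * c, by positivity, hyim.trans hvb⟩
    simpa using (principalIdeal u).add_mem h1 hwim

end BLComplexification

/-! ### Biorthogonal systems. -/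

section LinearAlgebra

variable {K X : Type*} [Field K] [AddCommGroup X] [Module K X]

/-- A separating set of functionals on a finite-dimensional space contains the dual basis of a
suitable basis. -/
theorem exists_biorthogonal_of_separating {m : ℕ} {v : Fin m → X} (hv : LinearIndependent K v)
    (F : Set (X →ₗ[K] K))
    (hF : ∀ x ∈ Submodule.span K (Set.range v), (∀ f ∈ F, f x = 0) → x = 0) :
    ∃ (w : Fin m → X) (f : Fin m → X →ₗ[K] K),
      (∀ i, w i ∈ Submodule.span K (Set.range v)) ∧ (∀ j, f j ∈ F) ∧
      ∀ i j, f j (w i) = if i = j then 1 else 0 := by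
  set W := Submodule.span K (Set.range v) with hW
  have hfd : FiniteDimensional K W := FiniteDimensional.span_of_finite K (Set.finite_range v)
  have hrank : Module.finrank K W = m := by
    rw [hW, finrank_span_eq_card hv, Fintype.card_fin]
  set F' : Set (Module.Dual K W) := (fun f : X →ₗ[K] K => f.comp W.subtype) '' F with hF'
  -- In finite dimension, functionals without a common zero span the dual. A basis chosen among them
  -- is dual to a basis of `W`, by reflexivity.
  have hspan : Submodule.span K F' = ⊤ := by
    have h0 : (Submodule.span K F').dualCoannihilator = ⊥ := by
      rw [eq_bot_iff]
      intro x hx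
      rw [Submodule.mem_dualCoannihilator] at hx
      have := hF x x.2 fun f hf => hx _ (Submodule.subset_span ⟨f, hf, rfl⟩)
      exact Subtype.ext this
    rw [← Subspace.dualCoannihilator_dualAnnihilator_eq (W := Submodule.span K F'), h0,
      Submodule.dualAnnihilator_bot]
  obtain ⟨b, hbF, hbspan, hbli⟩ := exists_linearIndependent K F'
  rw [hspan] at hbspan
  let B : Module.Basis b K (Module.Dual K W) :=
    Module.Basis.mk hbli (by rw [Subtype.range_coe, hbspan])
  have : Finite b := Module.Finite.finite_basis B
  have : Fintype b := Fintype.ofFinite b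
  have hcard : Fintype.card b = m := by
    rw [← Module.finrank_eq_card_basis B, Subspace.dual_finrank_eq, hrank]
  classical
  let B' := B.reindex (Fintype.equivFinOfCardEq hcard)
  have hB' : ∀ j, ∃ f ∈ F, f.comp W.subtype = B' j := by
    intro j
    have h1 : B' j ∈ F' := by
      rw [Module.Basis.reindex_apply, Module.Basis.mk_apply]
      exact hbF (Subtype.coe_prop _)
    exact h1
  choose f hf hfB using hB'
  refine ⟨fun i => ((Module.evalEquiv K W).symm (B'.dualBasis i) : W), f,
    fun i => Subtype.coe_prop _, hf, fun i j => ?_⟩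
  have h1 : f j ((Module.evalEquiv K W).symm (B'.dualBasis i) : W) =
      B' j ((Module.evalEquiv K W).symm (B'.dualBasis i)) := by
    rw [← hfB j]
    rfl
  rw [h1, Module.apply_evalEquiv_symm_apply, Module.Basis.dualBasis_apply_self]
  simp only [eq_comm]

theorem linearIndependent_of_biorthogonal {m : ℕ} {w : Fin m → X} {f : Fin m → X →ₗ[K] K}
    (h : ∀ i j, f j (w i) = if i = j then 1 else 0) : LinearIndependent K w := by
  rw [Fintype.linearIndependent_iff]
  intro g hg j
  have := congrArg (f j) hg
  simpa [map_sum, h] using this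

end LinearAlgebra

/-! ### Lattice homomorphisms modulo a closed ideal. -/

section Characters

variable {E : Type*} [NormedAddCommGroup E] [Lattice E] [HasSolidNorm E]
  [IsOrderedAddMonoid E] [NormedSpace ℝ E] [IsOrderedModule ℝ E] [CompleteSpace E]

/-- A real lattice homomorphism as a linear functional. -/
def IsLatticeCharacter.toLinearMap {V : Type*} [AddCommGroup V] [Lattice V] [Module ℝ V] {u : V}
    {φ : V → ℝ} (h : IsLatticeCharacter u φ) : V →ₗ[ℝ] ℝ where
  toFun := φ
  map_add' := h.map_add
  map_smul' := h.map_smul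

/-- Lattice homomorphisms on a principal ideal vanishing on a closed ideal `N` separate the points
of the principal ideal modulo `N`. -/
theorem mem_of_forall_isLatticeCharacter {u : E} (hu : 0 ≤ u) {N : Submodule ℝ E}
    (hN : IsLatticeIdeal N) (hclosed : IsClosed (N : Set E)) (v : principalIdeal u)
    (h : ∀ φ, IsLatticeCharacter (principalIdealUnit hu) φ →
      (∀ y : principalIdeal u, (y : E) ∈ N → φ y = 0) → φ v = 0) : (v : E) ∈ N := by
  set N' : Submodule ℝ (principalIdeal u) := N.comap (principalIdeal u).subtype with hN'def
  have hN' : IsLatticeIdeal N' := fun x y hxy hy => hN (x := (x : E)) (y := (y : E)) hxy hy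
  -- Otherwise some homomorphism vanishing on `N` would be at least `ε` at `|v|`. Letting `ε → 0`
  -- uses that `N` is closed.
  have hpos : ∀ ε : ℝ, 0 < ε → (|v| - ε • principalIdealUnit hu)⁺ ∈ N' := by
    intro ε hε
    by_contra hcon
    obtain ⟨φ, hφ, hφN, hφε⟩ :=
      exists_isLatticeCharacter (isStrongUnit_principalIdealUnit hu) hN' hcon
    rw [hφ.map_abs, h φ hφ fun y hy => hφN y hy, abs_zero] at hφε
    linarith
  have hpos' : ∀ ε : ℝ, 0 < ε → (|(v : E)| - ε • u) ⊔ 0 ∈ N := hpos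
  have hcont : Continuous fun ε : ℝ => (|(v : E)| - ε • u) ⊔ 0 := by fun_prop
  have hlim := (hcont.tendsto 0).mono_left (nhdsWithin_le_nhds (s := Set.Ioi 0))
  simp only [zero_smul, sub_zero] at hlim
  rw [sup_of_le_left (abs_nonneg (v : E))] at hlim
  exact hN (abs_abs (v : E)).ge
    (hclosed.mem_of_tendsto hlim (eventually_mem_nhdsWithin.mono fun ε hε => hpos' ε hε))

/-- Continuous functional calculus for two elements of a principal ideal. -/
theorem exists_functionalCalculus {u : E} (hu : 0 ≤ u) (x y : principalIdeal u)
    (G : C(ℝ × ℝ, ℝ)) : ∃ w : principalIdeal u,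
      ∀ φ, IsLatticeCharacter (principalIdealUnit hu) φ → φ w = G (φ x, φ y) := by
  obtain ⟨w, hw⟩ := exists_eval_eq (isStrongUnit_principalIdealUnit hu)
    (principalIdeal_archimedean hu) (principalIdeal_complete hu)
    ⟨fun φ => G (φ.1 x, φ.1 y), G.continuous.comp
      (((continuous_apply x).comp continuous_subtype_val).prodMk
        ((continuous_apply y).comp continuous_subtype_val))⟩
  exact ⟨w, fun φ hφ => hw ⟨φ, hφ⟩⟩

/-- The restriction of a positive operator to the principal ideal generated by a fixed vector. -/
def restrictPrincipalIdeal {T : E →L[ℝ] E} (hT : ∀ x, 0 ≤ x → 0 ≤ T x) {u : E} (hTu : T u = u) :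
    principalIdeal u →ₗ[ℝ] principalIdeal u :=
  (T : E →ₗ[ℝ] E).restrict (by
    rintro x ⟨c, hc, h⟩
    refine ⟨c, hc, (abs_map_le_of_positive hT x).trans ?_⟩
    rw [← hTu, ← map_smul]
    exact map_mono_of_positive hT h)

end Characters

/-! ### Monomials of eigenvectors and linear independence. -/

namespace BLComplexification

variable {E : Type*} [NormedAddCommGroup E] [Lattice E] [HasSolidNorm E]
  [IsOrderedAddMonoid E] [NormedSpace ℝ E] [IsOrderedModule ℝ E] [CompleteSpace E]

/-- The complexification of a real subspace. -/
def complexSubmodule (V : Submodule ℝ E) : Submodule ℂ (BLComplexification E) where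
  carrier := {z | z.re ∈ V ∧ z.im ∈ V}
  zero_mem' := ⟨V.zero_mem, V.zero_mem⟩
  add_mem' ha hb := ⟨V.add_mem ha.1 hb.1, V.add_mem ha.2 hb.2⟩
  smul_mem' _ _ hz := ⟨V.sub_mem (V.smul_mem _ hz.1) (V.smul_mem _ hz.2),
    V.add_mem (V.smul_mem _ hz.2) (V.smul_mem _ hz.1)⟩

/-- The complex linear extension of a real functional. -/
noncomputable def complexFunctional {V : Submodule ℝ E} (f : V →ₗ[ℝ] ℝ) :
    complexSubmodule V →ₗ[ℂ] ℂ where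
  toFun z := ⟨f ⟨z.1.re, z.2.1⟩, f ⟨z.1.im, z.2.2⟩⟩
  map_add' z w := by
    apply Complex.ext
    · exact map_add f ⟨z.1.re, z.2.1⟩ ⟨w.1.re, w.2.1⟩
    · exact map_add f ⟨z.1.im, z.2.2⟩ ⟨w.1.im, w.2.2⟩
  map_smul' c z := by
    apply Complex.ext
    · have e := f.map_sub (c.re • ⟨z.1.re, z.2.1⟩) (c.im • ⟨z.1.im, z.2.2⟩)
      rw [map_smul, map_smul] at e
      exact e.trans (Complex.mul_re c ⟨_, _⟩).symm
    · have e := f.map_add (c.re • ⟨z.1.im, z.2.2⟩) (c.im • ⟨z.1.re, z.2.1⟩)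
      rw [map_smul, map_smul] at e
      exact e.trans (Complex.mul_im c ⟨_, _⟩).symm

/-- The map `s ↦ s ^ k * conj s ^ l`. -/
noncomputable def conjMonomial (k l : ℕ) (s : ℂ) : ℂ := s ^ k * (starRingEnd ℂ s) ^ l

theorem continuous_conjMonomial (k l : ℕ) : Continuous (conjMonomial k l) := by
  unfold conjMonomial
  exact (continuous_id.pow k).mul (Complex.continuous_conj.pow l)

/-- Modulo the null ideal, the functional calculus maps eigenvectors to eigenvectors. -/
theorem IsPositiveOperator.exists_monomial
    {T : BLComplexification E →L[ℂ] BLComplexification E} (hT : IsPositiveOperator T)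
    {P : E →L[ℝ] E} (hP : IsCesaroLimit (realPart T) P) {u : E} (hu : 0 ≤ u)
    (hTu : realPart T u = u) {lam : ℂ} (hlam : ‖lam‖ = 1) (k l : ℕ)
    (z : complexSubmodule (principalIdeal u)) (hz : T z = lam • (z : BLComplexification E)) :
    ∃ w : complexSubmodule (principalIdeal u),
      (∀ φ (hφ : IsLatticeCharacter (principalIdealUnit hu) φ),
        complexFunctional hφ.toLinearMap w =
          conjMonomial k l (complexFunctional hφ.toLinearMap z)) ∧
      (T w - conjMonomial k l lam • (w : BLComplexification E)) ∈
        complexSubmodule (nullIdeal P (hP.positive hT.realPart_nonneg)) := by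
  set N := nullIdeal P (hP.positive hT.realPart_nonneg) with hNdef
  have hN : IsLatticeIdeal N := isLatticeIdeal_nullIdeal _ _
  have hNc : IsClosed (N : Set E) := isClosed_nullIdeal _ _
  set x : principalIdeal u := ⟨z.1.re, z.2.1⟩ with hx
  set y : principalIdeal u := ⟨z.1.im, z.2.2⟩ with hy
  set TV := restrictPrincipalIdeal hT.realPart_nonneg hTu with hTV
  have hTVpos : ∀ v, 0 ≤ v → 0 ≤ TV v := fun v hv => hT.realPart_nonneg v hv
  have hTV1 : TV (principalIdealUnit hu) = principalIdealUnit hu := Subtype.ext hTu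
  rw [hT.map_eq] at hz
  have hTx : TV x = lam.re • x - lam.im • y := Subtype.ext (congrArg re hz)
  have hTy : TV y = lam.re • y + lam.im • x := Subtype.ext (congrArg im hz)
  obtain ⟨h, hh⟩ := exists_functionalCalculus hu x y ⟨fun p => p.1 ^ 2 + p.2 ^ 2, by fun_prop⟩
  have hh' : ∀ φ, IsLatticeCharacter (principalIdealUnit hu) φ → φ h = φ x ^ 2 + φ y ^ 2 := hh
  have hpar : Continuous fun p : ℝ × ℝ => conjMonomial k l (p.1 + p.2 * Complex.I) :=
    (continuous_conjMonomial k l).comp (by fun_prop)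
  let G₁ : C(ℝ × ℝ, ℝ) :=
    ⟨fun p => (conjMonomial k l (p.1 + p.2 * Complex.I)).re, Complex.continuous_re.comp hpar⟩
  let G₂ : C(ℝ × ℝ, ℝ) :=
    ⟨fun p => (conjMonomial k l (p.1 + p.2 * Complex.I)).im, Complex.continuous_im.comp hpar⟩
  obtain ⟨p, hp⟩ := exists_functionalCalculus hu x y G₁
  obtain ⟨q, hq⟩ := exists_functionalCalculus hu x y G₂
  have harch := principalIdeal_archimedean hu
  have hunit := isStrongUnit_principalIdealUnit hu
  have hω : ∀ φ (hφ : IsLatticeCharacter (principalIdealUnit hu) φ),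
      (∀ v, 0 ≤ v → 0 ≤ (hφ.toLinearMap.comp TV) v) ∧
      (hφ.toLinearMap.comp TV) (principalIdealUnit hu) = 1 := by
    intro φ hφ
    refine ⟨fun v hv => hφ.nonneg (hTVpos v hv), ?_⟩
    rw [LinearMap.comp_apply, hTV1]
    exact hφ.map_unit
  have hφx : ∀ φ, IsLatticeCharacter (principalIdealUnit hu) φ →
      φ (TV x) = lam.re * φ x - lam.im * φ y := by
    intro φ hφ
    rw [hTx, hφ.map_sub, hφ.map_smul, hφ.map_smul]
  have hφy : ∀ φ, IsLatticeCharacter (principalIdealUnit hu) φ →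
      φ (TV y) = lam.re * φ y + lam.im * φ x := by
    intro φ hφ
    rw [hTy, hφ.map_add, hφ.map_smul, hφ.map_smul]
  have hlam2 : lam.re ^ 2 + lam.im ^ 2 = 1 := by
    have := Complex.sq_norm lam
    rw [hlam, Complex.normSq_apply] at this
    linarith
  -- `|λ z|² = |z|²`, because `‖λ‖ = 1`.
  have hsq : ∀ φ, IsLatticeCharacter (principalIdealUnit hu) φ →
      φ (TV x) ^ 2 + φ (TV y) ^ 2 = φ h := by
    intro φ hφ
    rw [hφx φ hφ, hφy φ hφ, hh' φ hφ]
    linear_combination (φ x ^ 2 + φ y ^ 2) * hlam2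
  have hTh : h ≤ TV h := by
    refine le_of_forall_isLatticeCharacter hunit harch fun φ hφ => ?_
    rw [← hsq φ hφ]
    exact sq_add_sq_le_of_positive hunit harch (hφ.toLinearMap.comp TV) (hω φ hφ).1 (hω φ hφ).2
      hh'
  -- The difference is positive and `P T = P` annihilates it.
  have hThN : ((TV h - h : principalIdeal u) : E) ∈ N := by
    have h0 : (0 : E) ≤ realPart T h - h := sub_nonneg.2 (show (h : E) ≤ realPart T h from hTh)
    change P |realPart T h - h| = 0
    rw [abs_of_nonneg h0, map_sub, hP.apply_map, sub_self]
  -- Where `φ` kills `T h - h`, equality holds in Jensen's inequality for `φ ∘ T`.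
  have heval : ∀ φ (hφ : IsLatticeCharacter (principalIdealUnit hu) φ),
      (∀ y : principalIdeal u, (y : E) ∈ N → φ y = 0) → ∀ (G : C(ℝ × ℝ, ℝ)) (w : principalIdeal u),
      (∀ φ, IsLatticeCharacter (principalIdealUnit hu) φ → φ w = G (φ x, φ y)) →
      φ (TV w) = G (φ (TV x), φ (TV y)) := by
    intro φ hφ hφN G w hw
    refine eval_eq_of_positive hunit harch (hφ.toLinearMap.comp TV) (hω φ hφ).1 (hω φ hφ).2 hh'
      ?_ G hw
    have h1 := hφN _ hThN
    rw [hφ.map_sub] at h1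
    have h2 := hsq φ hφ
    change φ (TV h) ≤ φ (TV x) ^ 2 + φ (TV y) ^ 2
    linarith
  have hmul : ∀ s t : ℂ, conjMonomial k l (s * t) = conjMonomial k l s * conjMonomial k l t := by
    intro s t
    simp only [conjMonomial, map_mul, mul_pow]
    ring
  have hcx : ∀ φ, IsLatticeCharacter (principalIdealUnit hu) φ →
      ((φ (TV x) : ℂ) + φ (TV y) * Complex.I) = lam * (φ x + φ y * Complex.I) := by
    intro φ hφ
    rw [hφx φ hφ, hφy φ hφ]
    apply Complex.ext <;> simp
  set μ := conjMonomial k l lam with hμ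
  refine ⟨⟨⟨p, q⟩, p.2, q.2⟩, ?_, ?_⟩
  · intro φ hφ
    have e : complexFunctional hφ.toLinearMap z = φ x + φ y * Complex.I := by
      apply Complex.ext <;> simp [complexFunctional, IsLatticeCharacter.toLinearMap, hx, hy]
    rw [e]
    exact Complex.ext (hp φ hφ) (hq φ hφ)
  · rw [hT.map_eq]
    constructor
    · refine mem_of_forall_isLatticeCharacter hu hN hNc (TV p - (μ.re • p - μ.im • q)) ?_
      intro φ hφ hφN
      have h1 := heval φ hφ hφN G₁ p hp
      have h2 : G₁ (φ (TV x), φ (TV y)) = μ.re * G₁ (φ x, φ y) - μ.im * G₂ (φ x, φ y) := by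
        change (conjMonomial k l _).re = _
        rw [hcx φ hφ, hmul]
        exact Complex.mul_re _ _
      rw [hφ.map_sub, hφ.map_sub, hφ.map_smul, hφ.map_smul, h1, h2, hp φ hφ, hq φ hφ, sub_self]
    · refine mem_of_forall_isLatticeCharacter hu hN hNc (TV q - (μ.re • q + μ.im • p)) ?_
      intro φ hφ hφN
      have h1 := heval φ hφ hφN G₂ q hq
      have h2 : G₂ (φ (TV x), φ (TV y)) = μ.re * G₂ (φ x, φ y) + μ.im * G₁ (φ x, φ y) := by
        change (conjMonomial k l _).im = _
        rw [hcx φ hφ, hmul]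
        exact Complex.mul_im _ _
      rw [hφ.map_sub, hφ.map_add, hφ.map_smul, hφ.map_smul, h1, h2, hp φ hφ, hq φ hφ, sub_self]

theorem eq_zero_of_modulus_le_zero {z : BLComplexification E} (h : modulus z ≤ 0) : z = 0 := by
  rw [← norm_eq_zero, norm_def, le_antisymm h (modulus_nonneg z), norm_zero]

theorem IsPositiveOperator.modulus_le_apply
    {T : BLComplexification E →L[ℂ] BLComplexification E} (hT : IsPositiveOperator T)
    {P : E →L[ℝ] E} (hP : IsCesaroLimit (realPart T) P) {lam : ℂ} (hlam : ‖lam‖ = 1)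
    {z : BLComplexification E} (hz : T z = lam • z) : modulus z ≤ P (modulus z) := by
  refine hP.le_apply hT.realPart_nonneg ?_
  have := hT.modulus_map_le z
  rwa [hz, modulus_smul, hlam, one_smul] at this

/-- On the unit circle conjugation is inversion. The extra `+ 1` in both exponents cancels there,
and makes the monomial vanish at `0` even for `n = 0`. -/
theorem conjMonomial_eq_zpow {lam : ℂ} (hlam : ‖lam‖ = 1) (n : ℤ) :
    conjMonomial (n.toNat + 1) ((-n).toNat + 1) lam = lam ^ n := by
  have h0 : lam ≠ 0 := by
    rintro rfl
    simp at hlam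
  have hc : (starRingEnd ℂ lam) = lam⁻¹ := by
    rw [Complex.inv_def, Complex.normSq_eq_norm_sq, hlam]
    simp
  rw [conjMonomial, hc, ← zpow_natCast, ← zpow_natCast, inv_zpow', ← zpow_add₀ h0]
  congr 1
  omega

/-- The monomial is not linear and may destroy independence, so the eigenvectors are first replaced
by a basis on which suitable homomorphisms take only the values `0` and `1`. -/
theorem IsPositiveOperator.exists_linearIndependent_eigenvectors
    {T : BLComplexification E →L[ℂ] BLComplexification E} (hT : IsPositiveOperator T)
    (hE : HasOrderContinuousNorm E) {P : E →L[ℝ] E} (hP : IsCesaroLimit (realPart T) P)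
    {lam : ℂ} (hlam : ‖lam‖ = 1) (n : ℤ) {m : ℕ} {z : Fin m → BLComplexification E}
    (hli : LinearIndependent ℂ z) (hz : ∀ i, T (z i) = lam • z i) :
    ∃ y : Fin m → BLComplexification E, LinearIndependent ℂ y ∧
      ∀ i, T (y i) = lam ^ n • y i := by
  have hPpos := hP.positive hT.realPart_nonneg
  set N := nullIdeal P hPpos with hNdef
  have hN : IsLatticeIdeal N := isLatticeIdeal_nullIdeal _ _
  set u : E := ∑ i, P (modulus (z i)) with hudef
  have hu : 0 ≤ u := Finset.sum_nonneg fun i _ => hPpos _ (modulus_nonneg _)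
  have hTu : realPart T u = u := by
    rw [hudef, map_sum]
    exact Finset.sum_congr rfl fun i _ => hP.map_apply _
  have hzu : ∀ i, modulus (z i) ≤ u := fun i =>
    (hT.modulus_le_apply hP hlam (hz i)).trans (Finset.single_le_sum
      (f := fun i => P (modulus (z i))) (fun j _ => hPpos _ (modulus_nonneg _))
      (Finset.mem_univ i))
  let z' : Fin m → complexSubmodule (principalIdeal u) := fun i =>
    ⟨z i, ⟨1, zero_le_one, by rw [one_smul]; exact (abs_re_le_modulus _).trans (hzu i)⟩,
      ⟨1, zero_le_one, by rw [one_smul]; exact (abs_im_le_modulus _).trans (hzu i)⟩⟩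
  have hli' : LinearIndependent ℂ z' :=
    LinearIndependent.of_comp (complexSubmodule (principalIdeal u)).subtype hli
  have hspan : ∀ x ∈ Submodule.span ℂ (Set.range z'),
      T x = lam • (x : BLComplexification E) := by
    intro x hx
    induction hx using Submodule.span_induction with
    | mem x hx =>
      obtain ⟨i, rfl⟩ := hx
      exact hz i
    | zero => simp
    | add x y _ _ hx hy => rw [Submodule.coe_add, map_add, hx, hy, smul_add]
    | smul c x _ hx => rw [Submodule.coe_smul, map_smul, hx, smul_comm]
  -- Separation: an eigenvector `x` killed by all these functionals has `|x| ∈ N`, hence `|x| ≤ P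
  -- |x| = 0`.
  obtain ⟨w, f, hw, hf, hfw⟩ := exists_biorthogonal_of_separating hli'
    {f | ∃ φ, ∃ hφ : IsLatticeCharacter (principalIdealUnit hu) φ,
      (∀ y : principalIdeal u, (y : E) ∈ N → φ y = 0) ∧
      f = complexFunctional hφ.toLinearMap} (by
    intro x hx hfx
    have hxN : ∀ φ, IsLatticeCharacter (principalIdealUnit hu) φ →
        (∀ y : principalIdeal u, (y : E) ∈ N → φ y = 0) →
        φ ⟨x.1.re, x.2.1⟩ = 0 ∧ φ ⟨x.1.im, x.2.2⟩ = 0 := by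
      intro φ hφ hφN
      have h1 := hfx _ ⟨φ, hφ, hφN, rfl⟩
      exact ⟨congrArg Complex.re h1, congrArg Complex.im h1⟩
    have hre : x.1.re ∈ N := mem_of_forall_isLatticeCharacter hu hN (isClosed_nullIdeal _ _)
      ⟨x.1.re, x.2.1⟩ fun φ hφ hφN => (hxN φ hφ hφN).1
    have him : x.1.im ∈ N := mem_of_forall_isLatticeCharacter hu hN (isClosed_nullIdeal _ _)
      ⟨x.1.im, x.2.2⟩ fun φ hφ hφN => (hxN φ hφ hφN).2
    have h2 : P |modulus x.1| = 0 := modulus_mem hN hre him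
    rw [abs_of_nonneg (modulus_nonneg _)] at h2
    exact Subtype.ext (eq_zero_of_modulus_le_zero
      ((hT.modulus_le_apply hP hlam (hspan x hx)).trans h2.le)))
  choose φ hφ hφN hfφ using hf
  choose v hv hvN using fun i => hT.exists_monomial hP hu hTu hlam (n.toNat + 1)
    ((-n).toNat + 1) (w i) (hspan _ (hw i))
  rw [conjMonomial_eq_zpow hlam] at hvN
  choose y hy hyre hyim hdre hdim using fun i =>
    hT.exists_eigenvector hE hP hu hTu (μ := lam ^ n) (by rw [norm_zpow, hlam, one_zpow])
      (v i).2.1 (v i).2.2 (hvN i).1 (hvN i).2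
  let y' : Fin m → complexSubmodule (principalIdeal u) := fun i => ⟨y i, hyre i, hyim i⟩
  -- The correction `y i - v i` lies in `N`, where `φ j` vanishes, and the monomial fixes `0` and
  -- `1`.
  have hbi : ∀ i j, f j (y' i) = if i = j then 1 else 0 := by
    intro i j
    have h1 : f j (y' i) = f j (v i) := by
      rw [← sub_eq_zero, ← map_sub, hfφ j]
      exact Complex.ext (hφN j ⟨_, (y' i - v i).2.1⟩ (hdre i))
        (hφN j ⟨_, (y' i - v i).2.2⟩ (hdim i))
    rw [h1, hfφ j, hv i (φ j) (hφ j), ← hfφ j, hfw]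
    split_ifs <;> simp [conjMonomial]
  exact ⟨y, (linearIndependent_of_biorthogonal hbi).map'
    (complexSubmodule (principalIdeal u)).subtype (Submodule.ker_subtype _), hy⟩

end BLComplexification

/-! ### Dimensions of eigenspaces and the conclusion. -/

section Dimension

variable {X : Type*} [NormedAddCommGroup X] [NormedSpace ℂ X]

theorem mem_ker_smul_id_sub {T : X →L[ℂ] X} {μ : ℂ} {x : X} :
    x ∈ LinearMap.ker ((μ • ContinuousLinearMap.id ℂ X - T : X →L[ℂ] X) : X →ₗ[ℂ] X) ↔
      T x = μ • x := by
  rw [LinearMap.mem_ker]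
  change μ • x - T x = 0 ↔ _
  rw [sub_eq_zero, eq_comm]

theorem natCast_le_dimKer_iff {T : X →L[ℂ] X} {μ : ℂ} {m : ℕ} :
    (m : ℕ∞) ≤ dimKer T μ ↔
      ∃ z : Fin m → X, LinearIndependent ℂ z ∧ ∀ i, T (z i) = μ • z i := by
  rw [dimKer, Cardinal.natCast_le_toENat]
  constructor
  · intro h
    obtain ⟨s, hs, hli⟩ := le_rank_iff_exists_linearIndependent_finset.1 h
    let e := s.equivFinOfCardEq hs
    have h1 := hli.comp e.symm e.symm.injective
    exact ⟨_, h1.map' (Submodule.subtype _) (Submodule.ker_subtype _),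
      fun i => mem_ker_smul_id_sub.1 (e.symm i).1.2⟩
  · rintro ⟨z, hli, hz⟩
    have h1 : LinearIndependent ℂ (fun i => (⟨z i, mem_ker_smul_id_sub.2 (hz i)⟩ :
        LinearMap.ker ((μ • ContinuousLinearMap.id ℂ X - T : X →L[ℂ] X) : X →ₗ[ℂ] X))) :=
      LinearIndependent.of_comp (Submodule.subtype _) hli
    simpa using h1.cardinal_lift_le_rank

theorem hasEigenvalue_iff_one_le_dimKer {T : X →L[ℂ] X} {μ : ℂ} :
    Module.End.HasEigenvalue (T : X →ₗ[ℂ] X) μ ↔ 1 ≤ dimKer T μ := by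
  rw [← Nat.cast_one, natCast_le_dimKer_iff]
  constructor
  · intro h
    obtain ⟨x, hx⟩ := h.exists_hasEigenvector
    exact ⟨fun _ => x, LinearIndependent.of_subsingleton 0 hx.2, fun _ => hx.apply_eq_smul⟩
  · rintro ⟨z, hli, hz⟩
    exact Module.End.hasEigenvalue_of_hasEigenvector
      (Module.End.hasEigenvector_iff.2 ⟨Module.End.mem_eigenspace_iff.2 (hz 0), hli.ne_zero 0⟩)

end Dimension

theorem mainTheorem4 {E : Type*} [NormedAddCommGroup E] [Lattice E] [HasSolidNorm E]
    [IsOrderedAddMonoid E] [NormedSpace ℝ E] [IsOrderedModule ℝ E] [CompleteSpace E]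
    (hE : HasOrderContinuousNorm E)
    (T : BLComplexification E →L[ℂ] BLComplexification E)
    (hpos : BLComplexification.IsPositiveOperator T)
    (hr : spectralRadius ℂ T = 1)
    (herg : IsMeanErgodic T) :
    (∀ (n : ℤ) (θ : ℝ),
      dimKer T (Complex.exp (Complex.I * θ)) ≤ dimKer T (Complex.exp (Complex.I * (n * θ)))) ∧
    IsCyclicSet (peripheralPointSpectrum T) := by
  obtain ⟨P, hP⟩ := herg
  have hP' := hpos.isCesaroLimit_realPart hP
  have hnorm : ∀ θ : ℝ, ‖Complex.exp (Complex.I * θ)‖ = 1 := fun θ => by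
    rw [mul_comm, Complex.norm_exp_ofReal_mul_I]
  have hpow : ∀ (n : ℤ) (θ : ℝ),
      Complex.exp (Complex.I * θ) ^ n = Complex.exp (Complex.I * (n * θ)) := fun n θ => by
    rw [← Complex.exp_int_mul]
    congr 1
    ring
  have hdim : ∀ (n : ℤ) (θ : ℝ),
      dimKer T (Complex.exp (Complex.I * θ)) ≤ dimKer T (Complex.exp (Complex.I * (n * θ))) := by
    intro n θ
    -- Comparing the natural numbers below both sides reduces everything, infinite dimension
    -- included, to finite independent families.
    refine ENat.forall_natCast_le_iff_le.1 fun m hm => ?_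
    obtain ⟨z, hli, hz⟩ := natCast_le_dimKer_iff.1 hm
    rw [← hpow, natCast_le_dimKer_iff]
    exact hpos.exists_linearIndependent_eigenvectors hE hP' (hnorm θ) n hli hz
  refine ⟨hdim, fun r θ hr0 hmem n => ?_⟩
  obtain ⟨heig, hrad⟩ := hmem
  have hr1 : r = 1 := by
    rw [hr, ← ofReal_norm, norm_mul, hnorm, mul_one, Complex.norm_real,
      Real.norm_of_nonneg hr0, ENNReal.ofReal_eq_one] at hrad
    exact hrad
  subst hr1
  rw [Complex.ofReal_one, one_mul] at heig ⊢
  refine ⟨hasEigenvalue_iff_one_le_dimKer.2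
    ((hasEigenvalue_iff_one_le_dimKer.1 heig).trans (hdim n θ)), ?_⟩
  rw [hr, ← ofReal_norm, ← hpow, norm_zpow, hnorm, one_zpow, ENNReal.ofReal_one]
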